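/- Let $R$ be a commutative (associative, unital) ring which is $\aleph_0$-Noetherian, i.e. every ideal of $R$ is generated by a countable set. Let $\mathrm{silp}\,R$ denote the supremum of the injective dimensions of all projective $R$-modules and let $\mathrm{spli}\,R$ denote the supremum of the projective dimensions of all injective $R$-modules; both suprema may be $\infty$, and the zero module is given dimension $-\infty$, which affects the suprema only when $R=0$. Then $$\mathrm{silp}\,R=\mathrm{spli}\,R .$$ -/

import Mathlib

open CategoryTheory

universe u

/-- A ring is (left) `ℵ₀`-Noetherian if each of its (left) ideals is generated by a countable
set. -/
def IsAlephZeroNoetherian (R : Type u) [Ring R] : Prop :=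
  ∀ I : Ideal R, ∃ S : Set R, S.Countable ∧ Ideal.span S = I

/-- `silp R`: the supremum of the injective dimensions of the projective (left) `R`-modules.
The injective dimension takes values in `{-∞, 0, 1, 2, …, ∞}`; it is `-∞ = ⊥` exactly for the
zero module, so that the zero module does not contribute to the supremum unless `R = 0`. -/
noncomputable def silp (R : Type u) [Ring R] : WithBot ℕ∞ :=
  ⨆ (P : ModuleCat.{u} R) (_ : Module.Projective R P), injectiveDimension P

/-- `spli R`: the supremum of the projective dimensions of the injective (left) `R`-modules,
with the same conventions on values as for `silp`. -/
noncomputable def spli (R : Type u) [Ring R] : WithBot ℕ∞ :=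
  ⨆ (I : ModuleCat.{u} R) (_ : Module.Injective R I), projectiveDimension I

/-! For each natural `n`, `silp R ≤ n` and `spli R ≤ n` are equivalent; the bridge is `Tor` against
injective modules. Over an `ℵ₀`-Noetherian ring, each `R/I` has, up to a free summand, a resolution
`d` by copies of `R^(ℕ)`. With `M` the cokernel of `d 0`, `HomExact d i Y` and `TensorExact d i N`
say that `Ext^{i+1}(M, Y)` and `Tor_{i+1}(M, N)` vanish. Such a resolution is the union of a
sequence of finite free subcomplexes, so `Ext` and `Tor` are linked through the tower of their
cohomology groups (`ProZero`): acyclicity for `Y` and `Y^(ℕ)` makes the tower pro-zero, which gives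
`Tor` vanishing against `Y⋆`; conversely, `Tor` vanishing against `(Y⋆)^ℕ` makes it pro-zero, and a
Mittag-Leffler argument returns to `Ext`.

If `spli R ≤ n`, take `Y` projective: powers of `Y⋆` are injective, so `Ext` into `Y` vanishes from
degree `n + 2` on. If `silp R ≤ n`, take `Y` free: every injective is a summand of some `Y⋆`, hence
has flat dimension at most `n`. Flat modules then have projective dimension at most `n`
(`IsAlephZeroNoetherian.hasProjectiveDimensionLT_of_flat`): countably generated ones have projective
dimension at most `1` by the same `Tor`-to-`Ext` passage, and the others are filtered by smaller
flat submodules and handled by Eklof's lemma. Both directions first yield a finite but too large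
bound, which `hasProjectiveDimensionLT_of_finite` and `hasInjectiveDimensionLT_of_finite` cut down
to `n`. -/

open TensorProduct Abelian Cardinal

section Complexes

variable {R : Type u} [CommRing R]

/-- The complex `⋯ → R^(ℕ) → R^(ℕ) → R^(ℕ)` with differentials `d i`, where `d i` goes from
degree `i + 1` to degree `i`, becomes exact in degree `i + 1` after applying `Hom(-, Y)`. -/
def HomExact (d : ℕ → (ℕ →₀ R) →ₗ[R] (ℕ →₀ R)) (i : ℕ) (Y : Type u) [AddCommGroup Y]
    [Module R Y] : Prop :=
  ∀ f : (ℕ →₀ R) →ₗ[R] Y, f ∘ₗ d (i + 1) = 0 → ∃ g : (ℕ →₀ R) →ₗ[R] Y, g ∘ₗ d i = f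

/-- The complex with differentials `d i` becomes exact in degree `i + 1` after applying
`- ⊗ N`. -/
def TensorExact (d : ℕ → (ℕ →₀ R) →ₗ[R] (ℕ →₀ R)) (i : ℕ) (N : Type u) [AddCommGroup N]
    [Module R N] : Prop :=
  Function.Exact ((d (i + 1)).rTensor N) ((d i).rTensor N)

variable {d : ℕ → (ℕ →₀ R) →ₗ[R] (ℕ →₀ R)}

/-! ### Dimension shifting for `Hom` and tensor exactness. -/

section Shift

variable {A B C : Type u} [AddCommGroup A] [AddCommGroup B] [AddCommGroup C]
  [Module R A] [Module R B] [Module R C]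

lemma Function.Exact.exists_factor {P M N Y : Type*} [AddCommGroup P] [AddCommGroup M]
    [AddCommGroup N] [AddCommGroup Y] [Module R P] [Module R M] [Module R N] [Module R Y]
    {f : P →ₗ[R] M} {g : M →ₗ[R] N} (h : Function.Exact f g) (φ : M →ₗ[R] Y)
    (hφ : φ ∘ₗ f = 0) : ∃ ψ : LinearMap.range g →ₗ[R] Y, ψ ∘ₗ g.rangeRestrict = φ := by
  have hk : LinearMap.ker g ≤ LinearMap.ker φ := by
    rw [h.linearMap_ker_eq]
    rintro _ ⟨x, rfl⟩
    exact LinearMap.congr_fun hφ x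
  refine ⟨(LinearMap.ker g).liftQ φ hk ∘ₗ g.quotKerEquivRange.symm.toLinearMap, ?_⟩
  ext x
  have : g.quotKerEquivRange.symm (g.rangeRestrict x) = Submodule.Quotient.mk x := by
    rw [LinearEquiv.symm_apply_eq]
    rfl
  simp [this]

lemma Function.Exact.apply_linearMap_eq_zero {P M N : Type*} [AddCommGroup P] [AddCommGroup M]
    [AddCommGroup N] [Module R P] [Module R M] [Module R N] {f : P →ₗ[R] M} {g : M →ₗ[R] N}
    (h : Function.Exact f g) (x : P) : g (f x) = 0 :=
  h.apply_apply_eq_zero x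

lemma exists_comp_of_range_le {M : Type*} [AddCommGroup M] [Module R M] {α : A →ₗ[R] B}
    (hα : Function.Injective α) (f : M →ₗ[R] B) (h : ∀ x, f x ∈ LinearMap.range α) :
    ∃ g : M →ₗ[R] A, α ∘ₗ g = f := by
  refine ⟨(LinearEquiv.ofInjective α hα).symm.toLinearMap ∘ₗ f.codRestrict _ h, ?_⟩
  ext x
  have := (LinearEquiv.ofInjective α hα).apply_symm_apply (f.codRestrict _ h x)
  exact congrArg Subtype.val this

lemma homExact_of_injective (hd : ∀ i, Function.Exact (d (i + 1)) (d i)) (i : ℕ)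
    [Module.Injective R A] : HomExact d i A := by
  intro f hf
  obtain ⟨ψ, hψ⟩ := (hd i).exists_factor f hf
  obtain ⟨g, hg⟩ := ‹Module.Injective R A›.out (X := LinearMap.range (d i))
    (LinearMap.range (d i)).subtype (Submodule.subtype_injective _) ψ
  refine ⟨g, ?_⟩
  rw [← hψ]
  exact LinearMap.ext fun x ↦ hg ((d i).rangeRestrict x)

/-- The connecting map `Ext^{i+1}(M, C) → Ext^{i+2}(M, A)` is onto because `B` is injective; the
diagram chase is done on cochains. -/
lemma HomExact.succ_of_shortExact (hd : ∀ i, Function.Exact (d (i + 1)) (d i))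
    {α : A →ₗ[R] B} {β : B →ₗ[R] C} (hα : Function.Injective α) (hβ : Function.Surjective β)
    (h : Function.Exact α β) [Module.Injective R B] {i : ℕ} (hC : HomExact d i C) :
    HomExact d (i + 1) A := by
  intro f hf
  obtain ⟨g, hg⟩ := homExact_of_injective hd (i + 1) (A := B) (α ∘ₗ f) (by
    rw [LinearMap.comp_assoc, hf, LinearMap.comp_zero])
  obtain ⟨k, hk⟩ := hC (β ∘ₗ g) (by
    rw [LinearMap.comp_assoc, hg, ← LinearMap.comp_assoc, h.linearMap_comp_eq_zero,
      LinearMap.zero_comp])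
  obtain ⟨k', rfl⟩ := Module.projective_lifting_property β k hβ
  obtain ⟨m, hm⟩ := exists_comp_of_range_le hα (g - k' ∘ₗ d i) (fun x ↦ by
    refine (h _).1 ?_
    simpa [sub_eq_zero] using (LinearMap.congr_fun hk x).symm)
  refine ⟨m, ?_⟩
  ext1 x
  ext1
  refine hα ?_
  have h1 := LinearMap.congr_fun hm (d (i + 1) (Finsupp.single x 1))
  have h2 := LinearMap.congr_fun hg (Finsupp.single x 1)
  simp only [LinearMap.comp_apply, LinearMap.sub_apply, (hd i).apply_linearMap_eq_zero, map_zero,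
    sub_zero] at h1 h2
  simp [h1, h2]

lemma HomExact.of_succ_of_shortExact (hd : ∀ i, Function.Exact (d (i + 1)) (d i))
    {α : A →ₗ[R] B} {β : B →ₗ[R] C} (hα : Function.Injective α) (hβ : Function.Surjective β)
    (h : Function.Exact α β) [Module.Injective R B] {i : ℕ} (hA : HomExact d (i + 1) A) :
    HomExact d i C := by
  intro f hf
  obtain ⟨g, rfl⟩ := Module.projective_lifting_property β f hβ
  obtain ⟨a, ha⟩ := exists_comp_of_range_le hα (g ∘ₗ d (i + 1)) (fun x ↦
    (h _).1 (LinearMap.congr_fun hf x))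
  obtain ⟨k, hk⟩ := hA a (by
    ext1 x
    ext1
    refine hα ?_
    have := LinearMap.congr_fun ha (d (i + 1 + 1) (Finsupp.single x 1))
    simp only [LinearMap.comp_apply, (hd (i + 1)).apply_linearMap_eq_zero, map_zero] at this
    simp [this])
  obtain ⟨m, hm⟩ := homExact_of_injective hd i (A := B) (g - α ∘ₗ k) (by
    rw [LinearMap.sub_comp, LinearMap.comp_assoc, hk, ha, sub_self])
  refine ⟨β ∘ₗ m, ?_⟩
  rw [LinearMap.comp_assoc, hm, LinearMap.comp_sub, ← LinearMap.comp_assoc,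
    h.linearMap_comp_eq_zero, LinearMap.zero_comp, sub_zero]

lemma tensorExact_of_flat (hd : ∀ i, Function.Exact (d (i + 1)) (d i)) (i : ℕ)
    [Module.Flat R A] : TensorExact d i A :=
  Module.Flat.rTensor_exact A (hd i)

lemma rTensor_lTensor_comm {P Q : Type*} [AddCommGroup P] [AddCommGroup Q] [Module R P]
    [Module R Q] (f : P →ₗ[R] Q) (g : A →ₗ[R] B) (x : P ⊗[R] A) :
    f.rTensor B (g.lTensor P x) = g.lTensor Q (f.rTensor A x) := by
  simp only [← LinearMap.comp_apply, LinearMap.rTensor_comp_lTensor,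
    LinearMap.lTensor_comp_rTensor]

/-- The terms `R^(ℕ)` are flat, so the sequence stays exact in each degree, and the middle complex
is acyclic because `B` is flat. -/
lemma TensorExact.succ_of_shortExact (hd : ∀ i, Function.Exact (d (i + 1)) (d i))
    {α : A →ₗ[R] B} {β : B →ₗ[R] C} (hα : Function.Injective α) (hβ : Function.Surjective β)
    (h : Function.Exact α β) [Module.Flat R B] {i : ℕ} (hA : TensorExact d i A) :
    TensorExact d (i + 1) C := by
  have hex := Module.Flat.lTensor_exact (ℕ →₀ R) h
  have hinj := Module.Flat.lTensor_preserves_injective_linearMap (M := ℕ →₀ R) α hα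
  have hsurj := LinearMap.lTensor_surjective (ℕ →₀ R) hβ
  have hB := fun i ↦ tensorExact_of_flat (A := B) hd i
  have hB₀ : ∀ i x, (d i).rTensor B ((d (i + 1)).rTensor B x) = 0 :=
    fun i ↦ (hB i).apply_apply_eq_zero
  have hex₀ : ∀ x, β.lTensor (ℕ →₀ R) (α.lTensor _ x) = 0 := hex.apply_apply_eq_zero
  have hzero : ∀ (i : ℕ) x, (d i).rTensor C ((d (i + 1)).rTensor C x) = 0 := fun i x ↦ by
    obtain ⟨y, rfl⟩ := hsurj x
    rw [rTensor_lTensor_comm, rTensor_lTensor_comm, hB₀, map_zero]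
  intro c
  refine ⟨fun hc ↦ ?_, fun ⟨w, hw⟩ ↦ hw ▸ hzero _ w⟩
  obtain ⟨y, rfl⟩ := hsurj c
  rw [rTensor_lTensor_comm] at hc
  obtain ⟨z, hz⟩ := (hex _).1 hc
  obtain ⟨v, rfl⟩ := (hA z).1 (hinj (by
    rw [map_zero, ← rTensor_lTensor_comm, hz, hB₀]))
  obtain ⟨w, hw⟩ := (hB (i + 1) (y - α.lTensor _ v)).1 (by
    rw [map_sub, rTensor_lTensor_comm, hz, sub_self])
  refine ⟨β.lTensor _ w, ?_⟩
  rw [rTensor_lTensor_comm, hw, map_sub, hex₀]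
  exact sub_zero (β.lTensor (ℕ →₀ R) y)

lemma TensorExact.of_succ_of_shortExact (hd : ∀ i, Function.Exact (d (i + 1)) (d i))
    {α : A →ₗ[R] B} {β : B →ₗ[R] C} (hα : Function.Injective α) (hβ : Function.Surjective β)
    (h : Function.Exact α β) [Module.Flat R B] {i : ℕ} (hC : TensorExact d (i + 1) C) :
    TensorExact d i A := by
  have hex := Module.Flat.lTensor_exact (ℕ →₀ R) h
  have hinj := Module.Flat.lTensor_preserves_injective_linearMap (M := ℕ →₀ R) α hα
  have hsurj := LinearMap.lTensor_surjective (ℕ →₀ R) hβ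
  have hB := fun i ↦ tensorExact_of_flat (A := B) hd i
  have hB₀ : ∀ i x, (d i).rTensor B ((d (i + 1)).rTensor B x) = 0 :=
    fun i ↦ (hB i).apply_apply_eq_zero
  have hex₀ : ∀ x, β.lTensor (ℕ →₀ R) (α.lTensor _ x) = 0 := hex.apply_apply_eq_zero
  intro c
  refine ⟨fun hc ↦ ?_, ?_⟩
  · obtain ⟨w, hw⟩ := (hB i (α.lTensor _ c)).1 (by rw [rTensor_lTensor_comm, hc, map_zero])
    obtain ⟨v, hv⟩ := (hC (β.lTensor _ w)).1 (by
      rw [rTensor_lTensor_comm, hw, hex₀])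
    obtain ⟨v, rfl⟩ := hsurj v
    obtain ⟨u, hu⟩ := (hex (w - (d (i + 1 + 1)).rTensor B v)).1 (by
      rw [map_sub, ← hv, rTensor_lTensor_comm, sub_self])
    refine ⟨u, hinj ?_⟩
    rw [← rTensor_lTensor_comm, hu, map_sub, hB₀]
    exact (sub_zero _).trans hw
  · rintro ⟨w, rfl⟩
    refine hinj ?_
    rw [map_zero, ← rTensor_lTensor_comm, ← rTensor_lTensor_comm, hB₀]

end Shift

/-! ### Exhausting the complex by finite free subcomplexes -/

/-- Finite sets of basis vectors spanning an exhausting sequence of finite free subcomplexes. -/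
noncomputable def finiteBasis (d : ℕ → (ℕ →₀ R) →ₗ[R] (ℕ →₀ R)) (k : ℕ) : ℕ → Finset ℕ
  | 0 => Finset.range k
  | i + 1 => by
    classical
    exact (Finset.range k).filter fun j ↦ (d i (Finsupp.single j 1)).support ⊆ finiteBasis d k i

lemma mem_finiteBasis_succ {k i j : ℕ} : j ∈ finiteBasis d k (i + 1) ↔
    j < k ∧ (d i (Finsupp.single j 1)).support ⊆ finiteBasis d k i := by
  classical
  simp [finiteBasis]

lemma finiteBasis_mono {k l : ℕ} (h : k ≤ l) (i : ℕ) :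
    finiteBasis d k i ⊆ finiteBasis d l i := by
  induction i with
  | zero => simpa [finiteBasis] using h
  | succ i ih =>
    intro j hj
    rw [mem_finiteBasis_succ] at hj ⊢
    exact ⟨hj.1.trans_le h, hj.2.trans ih⟩

/-- A basis vector is kept once its boundary lies in the part already kept one degree lower. That
boundary has finite support, so induction on the degree gives exhaustion. -/
lemma exists_subset_finiteBasis (i : ℕ) (t : Finset ℕ) : ∃ k, t ⊆ finiteBasis d k i := by
  have key : ∀ i, (∀ j, ∃ k, j ∈ finiteBasis d k i) →
      ∀ t : Finset ℕ, ∃ k, t ⊆ finiteBasis d k i := by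
    intro i h t
    choose k hk using h
    exact ⟨t.sup k, fun j hj ↦ finiteBasis_mono (Finset.le_sup hj) i (hk j)⟩
  refine key i ?_ t
  induction i with
  | zero => exact fun j ↦ ⟨j + 1, by simp [finiteBasis]⟩
  | succ i ih =>
    intro j
    obtain ⟨k, hk⟩ := key i ih (d i (Finsupp.single j 1)).support
    exact ⟨max k (j + 1), mem_finiteBasis_succ.2 ⟨by simp,
      hk.trans (finiteBasis_mono (le_max_left _ _) i)⟩⟩

lemma apply_eq_of_eqOn {Y : Type*} [AddCommGroup Y] [Module R Y] {f g : (ℕ →₀ R) →ₗ[R] Y}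
    {s : Finset ℕ} (h : ∀ j ∈ s, f (Finsupp.single j 1) = g (Finsupp.single j 1))
    {x : ℕ →₀ R} (hx : x.support ⊆ s) : f x = g x := by
  rw [← Finsupp.sum_single x, Finsupp.sum, map_sum, map_sum]
  refine Finset.sum_congr rfl fun j hj ↦ ?_
  rw [← mul_one (x j), ← smul_eq_mul, ← Finsupp.smul_single, map_smul, map_smul, h j (hx hj)]

lemma apply_eq_of_eqOn_finiteBasis {Y : Type*} [AddCommGroup Y] [Module R Y]
    {f g : (ℕ →₀ R) →ₗ[R] Y} {k i : ℕ}
    (h : ∀ j ∈ finiteBasis d k i, f (Finsupp.single j 1) = g (Finsupp.single j 1))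
    {j : ℕ} (hj : j ∈ finiteBasis d k (i + 1)) :
    f (d i (Finsupp.single j 1)) = g (d i (Finsupp.single j 1)) :=
  apply_eq_of_eqOn h (mem_finiteBasis_succ.1 hj).2

/-- Every cocycle in degree `i + 1` on a sufficiently large finite subcomplex becomes a coboundary
after restriction to a given finite subcomplex. -/
def ProZero (d : ℕ → (ℕ →₀ R) →ₗ[R] (ℕ →₀ R)) (i : ℕ) (Y : Type u) [AddCommGroup Y]
    [Module R Y] : Prop :=
  ∀ k, ∃ l, ∀ f : (ℕ →₀ R) →ₗ[R] Y,
    (∀ j ∈ finiteBasis d l (i + 2), f (d (i + 1) (Finsupp.single j 1)) = 0) →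
    ∃ g : (ℕ →₀ R) →ₗ[R] Y, ∀ j ∈ finiteBasis d k (i + 1),
      g (d i (Finsupp.single j 1)) = f (Finsupp.single j 1)

variable {Y : Type u} [AddCommGroup Y] [Module R Y]

/-- If a tower of cohomology groups stays acyclic after countable direct sums, it is pro-zero. -/
lemma ProZero.of_homExact (hd : ∀ i, Function.Exact (d (i + 1)) (d i)) {i : ℕ}
    (h : HomExact d i Y) (h' : HomExact d (i + 1) (ℕ →₀ Y)) : ProZero d i Y := by
  by_contra hcon
  simp only [ProZero, not_forall, not_exists] at hcon
  obtain ⟨k, hk⟩ := hcon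
  choose f hf hfg using hk
  -- The bad `f l` is a cocycle at level `l`, so each basis vector sees only finitely many nonzero
  -- `f l ∘ d (i + 1)`: together these form one cocycle with values in `Y^(ℕ)`.
  have hfin : ∀ j, (Function.support fun l ↦ f l (d (i + 1) (Finsupp.single j 1))).Finite := by
    intro j
    obtain ⟨l₀, hl₀⟩ := exists_subset_finiteBasis (d := d) (i + 2) {j}
    refine (Set.finite_lt_nat l₀).subset fun l hl ↦ ?_
    by_contra hlt
    exact hl (hf l j (finiteBasis_mono (not_lt.1 hlt) _ (hl₀ (by simp))))
  let Φ : (ℕ →₀ R) →ₗ[R] (ℕ →₀ Y) :=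
    Finsupp.linearCombination R fun j ↦ Finsupp.ofSupportFinite _ (hfin j)
  have hΦ : ∀ l, Finsupp.lapply l ∘ₗ Φ = f l ∘ₗ d (i + 1) := by
    intro l
    ext j
    simp [Φ, Finsupp.ofSupportFinite]
    rfl
  obtain ⟨G, hG⟩ := h' Φ (by
    ext1 j
    ext1
    refine Finsupp.ext fun l ↦ ?_
    have := LinearMap.congr_fun (hΦ l) (d (i + 1 + 1) (Finsupp.single j 1))
    simpa [(hd (i + 1)).apply_linearMap_eq_zero] using this)
  -- On the finite level `k`, `G` has only finitely many nonzero coordinates. For any other `l`, the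
  -- global cocycle `f l - G_l` agrees there with `f l`, so `f l` is a coboundary at level `k`.
  obtain ⟨l, hl⟩ := Infinite.exists_notMem_finset
    ((finiteBasis d k (i + 1)).biUnion fun j ↦ (G (Finsupp.single j 1)).support)
  obtain ⟨g, hg⟩ := h (f l - Finsupp.lapply l ∘ₗ G) (by
    rw [LinearMap.sub_comp, LinearMap.comp_assoc, hG, hΦ, sub_self])
  obtain ⟨j, hj, hne⟩ := hfg l g
  refine hne ?_
  have h1 := LinearMap.congr_fun hg (Finsupp.single j 1)
  have h2 : G (Finsupp.single j 1) l = 0 := by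
    by_contra h0
    exact hl (Finset.mem_biUnion.2 ⟨j, hj, Finsupp.mem_support_iff.2 h0⟩)
  simpa [h2] using h1

/-- A Mittag-Leffler argument: the cohomology of the whole complex vanishes if the towers of
cohomology groups of the finite subcomplexes are pro-zero in two consecutive degrees. -/
lemma HomExact.of_proZero (hd : ∀ i, Function.Exact (d (i + 1)) (d i)) {i : ℕ}
    (h : ProZero d i Y) (h' : ProZero d (i + 1) Y) : HomExact d (i + 1) Y := by
  intro f hf
  have hloc : ∀ k, ∃ g : (ℕ →₀ R) →ₗ[R] Y, ∀ j ∈ finiteBasis d k (i + 2),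
      g (d (i + 1) (Finsupp.single j 1)) = f (Finsupp.single j 1) := fun k ↦ by
    obtain ⟨l, hl⟩ := h' k
    exact hl f fun j _ ↦ LinearMap.congr_fun hf (Finsupp.single j 1)
  choose l hl using h
  -- Levels are spaced so that a cocycle at level `K (n + 1)` is a coboundary at level `K n + 1`;
  -- the first term of the maximum makes them exhaust the complex.
  obtain ⟨K, hKsucc⟩ : ∃ K : ℕ → ℕ, ∀ n, K (n + 1) = max (K n + 1) (l (K n + 1)) :=
    ⟨fun n ↦ Nat.rec 0 (fun _ k ↦ max (k + 1) (l (k + 1))) n, fun _ ↦ rfl⟩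
  have hKmono : StrictMono K := strictMono_nat_of_lt_succ fun n ↦ by
    rw [hKsucc]; exact (Nat.lt_succ_self _).trans_le (le_max_left _ _)
  let S : ℕ → ((ℕ →₀ R) →ₗ[R] Y) → Prop := fun n g ↦ ∀ j ∈ finiteBasis d (K (n + 1)) (i + 2),
      g (d (i + 1) (Finsupp.single j 1)) = f (Finsupp.single j 1)
  -- Two local solutions differ by a cocycle at the smaller level. Adding a coboundary to the new
  -- solution makes it agree with the old one further down, so the corrected solutions converge.
  have step : ∀ n (g : { g // S n g }), ∃ g' : { g // S (n + 1) g },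
      ∀ j ∈ finiteBasis d (K n) (i + 1),
        g'.1 (Finsupp.single j 1) = g.1 (Finsupp.single j 1) := by
    rintro n ⟨g, hg⟩
    obtain ⟨g₁, hg₁⟩ := hloc (K (n + 1 + 1))
    obtain ⟨e, he⟩ := hl (K n + 1) (g - g₁) (fun j hj ↦ by
      have hj' : j ∈ finiteBasis d (K (n + 1)) (i + 2) :=
        finiteBasis_mono (by rw [hKsucc]; exact le_max_right _ _) _ hj
      rw [LinearMap.sub_apply, hg j hj', hg₁ j (finiteBasis_mono
        (hKmono.monotone (Nat.le_succ _)) (i + 2) hj'), sub_self])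
    refine ⟨⟨g₁ + e ∘ₗ d i, fun j hj ↦ ?_⟩, fun j hj ↦ ?_⟩
    · simp [hg₁ j hj, (hd i).apply_linearMap_eq_zero]
    · simp [he j (finiteBasis_mono (Nat.le_succ _) _ hj)]
  choose next hnext using step
  obtain ⟨g₀, hg₀⟩ := hloc (K 1)
  obtain ⟨G, hG⟩ : ∃ G : ∀ n, { g // S n g }, ∀ n, ∀ j ∈ finiteBasis d (K n) (i + 1),
      (G (n + 1)).1 (Finsupp.single j 1) = (G n).1 (Finsupp.single j 1) :=
    ⟨fun n ↦ Nat.rec ⟨g₀, hg₀⟩ (fun n g ↦ next n g) n, fun n ↦ hnext n _⟩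
  have hGle : ∀ n m, n ≤ m → ∀ j ∈ finiteBasis d (K n) (i + 1),
      (G m).1 (Finsupp.single j 1) = (G n).1 (Finsupp.single j 1) := by
    intro n m hnm j hj
    induction m, hnm using Nat.le_induction with
    | base => rfl
    | succ m hnm ih =>
      rw [hG m j (finiteBasis_mono (hKmono.monotone hnm) _ hj), ih]
  have hex : ∀ j, ∃ n, j ∈ finiteBasis d (K n) (i + 1) := fun j ↦ by
    obtain ⟨k, hk⟩ := exists_subset_finiteBasis (d := d) (i + 1) {j}
    exact ⟨k, finiteBasis_mono hKmono.le_apply _ (hk (by simp))⟩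
  choose N hN using hex
  let g : (ℕ →₀ R) →ₗ[R] Y :=
    Finsupp.linearCombination R fun j ↦ (G (N j)).1 (Finsupp.single j 1)
  have hg : ∀ n, ∀ j ∈ finiteBasis d (K n) (i + 1),
      g (Finsupp.single j 1) = (G n).1 (Finsupp.single j 1) := by
    intro n j hj
    have : g (Finsupp.single j 1) = (G (N j)).1 (Finsupp.single j 1) := by simp [g]
    rw [this, ← hGle _ _ (le_max_left (N j) n) j (hN j), hGle _ _ (le_max_right (N j) n) j hj]
  refine ⟨g, ?_⟩
  ext1 j
  ext1
  obtain ⟨n, hn⟩ := exists_subset_finiteBasis (d := d) (i + 2) {j}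
  have hj : j ∈ finiteBasis d (K n) (i + 2) := finiteBasis_mono hKmono.le_apply _ (hn (by simp))
  have h1 := apply_eq_of_eqOn_finiteBasis (hg n) hj
  have h2 := (G n).2 j (finiteBasis_mono (hKmono.monotone (Nat.le_succ n)) _ hj)
  simpa using h1.trans h2

/-! ### Duality with characters -/

/-- The pairing of `f : R^(ℕ) → Y` with elements of `R^(ℕ) ⊗ Y⋆`. -/
noncomputable def evalPairing (f : (ℕ →₀ R) →ₗ[R] Y) :
    (ℕ →₀ R) ⊗[R] CharacterModule Y →+ AddCircle (1 : ℚ) :=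
  TensorProduct.liftAddHom
    { toFun := fun x ↦
        { toFun := fun χ ↦ χ (f x)
          map_zero' := rfl
          map_add' := fun _ _ ↦ rfl }
      map_zero' := by ext χ; simp
      map_add' := fun x y ↦ by ext χ; simp; rfl }
    (fun r x χ ↦ by simp; rfl)

@[simp] lemma evalPairing_tmul (f : (ℕ →₀ R) →ₗ[R] Y) (x : ℕ →₀ R) (χ : CharacterModule Y) :
    evalPairing f (x ⊗ₜ χ) = χ (f x) := rfl

lemma evalPairing_rTensor (f : (ℕ →₀ R) →ₗ[R] Y) (e : (ℕ →₀ R) →ₗ[R] (ℕ →₀ R))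
    (c : (ℕ →₀ R) ⊗[R] CharacterModule Y) :
    evalPairing f (e.rTensor _ c) = evalPairing (f ∘ₗ e) c := by
  induction c with
  | zero => simp
  | tmul x χ => simp
  | add a b ha hb => simp [ha, hb]

lemma exists_sum_single_tmul {N : Type*} [AddCommGroup N] [Module R N]
    (c : (ℕ →₀ R) ⊗[R] N) : ∃ v : ℕ →₀ N,
    c = ∑ j ∈ v.support, (Finsupp.single j (1 : R)) ⊗ₜ[R] v j := by
  refine ⟨finsuppScalarLeft R N ℕ c, ?_⟩
  apply (finsuppScalarLeft R N ℕ).injective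
  rw [map_sum]
  conv_lhs => rw [← Finsupp.sum_single (finsuppScalarLeft R N ℕ c)]
  refine Finset.sum_congr rfl fun j _ ↦ ?_
  simp [finsuppScalarLeft_apply_tmul]

/-- Maps `f` supported on a single basis vector read off the value of each character at each `y`. -/
lemma eq_zero_of_evalPairing {c : (ℕ →₀ R) ⊗[R] (ℕ → CharacterModule Y)}
    (h : ∀ (f : (ℕ →₀ R) →ₗ[R] Y) (l : ℕ),
      evalPairing f ((LinearMap.proj l : (ℕ → CharacterModule Y) →ₗ[R] _).lTensor _ c) = 0) :
    c = 0 := by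
  obtain ⟨v, rfl⟩ := exists_sum_single_tmul c
  refine Finset.sum_eq_zero fun j hj ↦ ?_
  suffices hv : v j = 0 by rw [hv, TensorProduct.tmul_zero]
  funext l
  ext y
  have := h (Finsupp.linearCombination R (Pi.single j y)) l
  simp only [map_sum, LinearMap.lTensor_tmul, evalPairing_tmul, LinearMap.proj_apply,
    Finsupp.linearCombination_single, one_smul] at this
  rw [Finset.sum_eq_single_of_mem j hj] at this
  · simp only [Pi.single_eq_same] at this
    exact this
  · intro b _ hb
    simp [hb]

end Complexes

section Duality

variable {R : Type u} [CommRing R] {d : ℕ → (ℕ →₀ R) →ₗ[R] (ℕ →₀ R)}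
  {Y : Type u} [AddCommGroup Y] [Module R Y]

lemma exists_character_of_notMem {V : Type*} [AddCommGroup V] [Module R V] (B : Submodule R V)
    {x : V} (hx : x ∉ B) :
    ∃ χ : CharacterModule V, (∀ y ∈ B, χ y = 0) ∧ χ x ≠ 0 := by
  obtain ⟨c, hc⟩ := CharacterModule.exists_character_apply_ne_zero_of_ne_zero
    (a := B.mkQ x) (by simpa using hx)
  refine ⟨CharacterModule.dual B.mkQ c, fun y hy ↦ ?_, hc⟩
  have : B.mkQ y = 0 := by simpa using hy
  exact (congrArg c this).trans (map_zero c)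

lemma character_eq_sum {s : Finset ℕ} (χ : CharacterModule (s → Y)) (v : s → Y) :
    χ v = ∑ j : s, χ (Pi.single j (v j)) := by
  rw [← map_sum, Finset.univ_sum_single]

/-- The restriction of `f ∘ e` to a finite set of basis vectors. -/
noncomputable def restrictComp (e : (ℕ →₀ R) →ₗ[R] (ℕ →₀ R)) (s : Finset ℕ) :
    ((ℕ →₀ R) →ₗ[R] Y) →ₗ[R] (s → Y) where
  toFun f j := f (e (Finsupp.single j 1))
  map_add' _ _ := rfl
  map_smul' _ _ := rfl

/-- If the tower is not pro-zero, characters `χ l` of the finite power `Y^s` kill coboundaries but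
not the bad cocycles `f l`. All `χ l` together form one cycle with coefficients in `(Y⋆)^ℕ`. It
bounds a chain of finite support, hence one inside some level `l`; pairing with `f l` there gives
zero, a contradiction. The infinite power makes this support uniform in `l`. -/
lemma ProZero.of_tensorExact {i : ℕ} (h : TensorExact d i (ℕ → CharacterModule Y)) :
    ProZero d i Y := by
  by_contra hcon
  simp only [ProZero, not_forall, not_exists] at hcon
  obtain ⟨k, hk⟩ := hcon
  choose f hf hfg using hk
  set s := finiteBasis d k (i + 1) with hs
  have hnot : ∀ l, restrictComp .id s (f l) ∉ LinearMap.range (restrictComp (Y := Y) (d i) s) := by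
    rintro l ⟨g, hg⟩
    obtain ⟨j, hj, hne⟩ := hfg l g
    exact hne (congrFun hg ⟨j, hj⟩)
  choose χ hχ hχ' using fun l ↦ exists_character_of_notMem _ (hnot l)
  let c : (ℕ →₀ R) ⊗[R] (ℕ → CharacterModule Y) :=
    ∑ j : s, Finsupp.single (j : ℕ) (1 : R) ⊗ₜ fun l ↦
      CharacterModule.dual (LinearMap.single R (fun _ ↦ Y) j) (χ l)
  have hc : ∀ (g : (ℕ →₀ R) →ₗ[R] Y) (l : ℕ), evalPairing g
      ((LinearMap.proj l : (ℕ → CharacterModule Y) →ₗ[R] _).lTensor _ c) =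
        χ l (restrictComp .id s g) := by
    intro g l
    rw [character_eq_sum]
    simp only [c, map_sum, LinearMap.lTensor_tmul, evalPairing_tmul]
    rfl
  have hc0 : (d i).rTensor _ c = 0 := by
    refine eq_zero_of_evalPairing fun g l ↦ ?_
    rw [← rTensor_lTensor_comm, evalPairing_rTensor, hc]
    exact hχ l _ ⟨g, rfl⟩
  obtain ⟨w, hw⟩ := (h c).1 hc0
  obtain ⟨v, hv⟩ := exists_sum_single_tmul w
  obtain ⟨l, hl⟩ := exists_subset_finiteBasis (d := d) (i + 2) v.support
  refine hχ' l ?_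
  rw [← hc, ← hw, ← rTensor_lTensor_comm, evalPairing_rTensor, hv, map_sum, map_sum]
  refine Finset.sum_eq_zero fun j hj ↦ ?_
  rw [LinearMap.lTensor_tmul, evalPairing_tmul, LinearMap.comp_apply, hf l j (hl hj), map_zero]

/-- A cycle `c` is a functional on cochains that kills coboundaries and depends only on a finite
level `k`. By pro-zeroness it kills cochains that are cocycles at a larger level `l`, so it factors
through the restricted coboundary map into `Y^t`. Extending it to a character of `Y^t` gives a chain
with boundary `c`. -/
lemma TensorExact.of_proZero (hd : ∀ i, Function.Exact (d (i + 1)) (d i)) {i : ℕ}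
    (h : ProZero d i Y) : TensorExact d i (CharacterModule Y) := by
  have hzero : (d i).rTensor (CharacterModule Y) ∘ₗ (d (i + 1)).rTensor _ = 0 := by
    rw [← LinearMap.rTensor_comp, (hd i).linearMap_comp_eq_zero, LinearMap.rTensor_zero]
  intro c
  refine ⟨fun hc ↦ ?_, fun ⟨w, hw⟩ ↦ hw ▸ LinearMap.congr_fun hzero w⟩
  obtain ⟨v, rfl⟩ := exists_sum_single_tmul c
  obtain ⟨k, hk⟩ := exists_subset_finiteBasis (d := d) (i + 1) v.support
  obtain ⟨l, hl⟩ := h k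
  set c := ∑ j ∈ v.support, Finsupp.single j (1 : R) ⊗ₜ[R] v j with hcdef
  have hev : ∀ f g : (ℕ →₀ R) →ₗ[R] Y, (∀ j ∈ finiteBasis d k (i + 1),
      g (Finsupp.single j 1) = f (Finsupp.single j 1)) → evalPairing f c = evalPairing g c := by
    intro f g hfg
    rw [hcdef, map_sum, map_sum]
    refine Finset.sum_congr rfl fun j hj ↦ ?_
    rw [evalPairing_tmul, evalPairing_tmul, hfg j (hk hj)]
  have hcob : ∀ g : (ℕ →₀ R) →ₗ[R] Y, evalPairing (g ∘ₗ d i) c = 0 := fun g ↦ by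
    rw [← evalPairing_rTensor, hc, map_zero]
  set t := finiteBasis d l (i + 2) with ht
  let r := restrictComp (Y := Y) (d (i + 1)) t
  let C : CharacterModule ((ℕ →₀ R) →ₗ[R] Y) :=
    { toFun := fun f ↦ evalPairing f c
      map_zero' := by simpa using hcob 0
      map_add' := fun f g ↦ by
        simp only [hcdef, map_sum, evalPairing_tmul, LinearMap.add_apply, map_add,
          Finset.sum_add_distrib] }
  have hC : ∀ f, C f = evalPairing f c := fun _ ↦ rfl
  have hker : ∀ f, r f = 0 → C f = 0 := by
    intro f hf
    obtain ⟨g, hg⟩ := hl f fun j hj ↦ congrFun hf ⟨j, hj⟩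
    rw [hC, hev f (g ∘ₗ d i) hg, hcob]
  let C' : CharacterModule (((ℕ →₀ R) →ₗ[R] Y) ⧸ LinearMap.ker r) :=
    QuotientAddGroup.lift (LinearMap.ker r).toAddSubgroup C hker
  obtain ⟨ω, hω⟩ := CharacterModule.dual_surjective_of_injective
    ((LinearMap.ker r).liftQ r le_rfl) (LinearMap.ker_eq_bot.1 (by simp [Submodule.ker_liftQ])) C'
  have hωC : ∀ f, ω (r f) = evalPairing f c := fun f ↦
    DFunLike.congr_fun hω (Submodule.Quotient.mk f)
  let w : (ℕ →₀ R) ⊗[R] CharacterModule Y :=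
    ∑ j : t, Finsupp.single (j : ℕ) (1 : R) ⊗ₜ
      CharacterModule.dual (LinearMap.single R (fun _ ↦ Y) j) ω
  refine ⟨w, ?_⟩
  have hpair : ∀ f : (ℕ →₀ R) →ₗ[R] Y, evalPairing f ((d (i + 1)).rTensor _ w - c) = 0 := by
    intro f
    rw [map_sub, evalPairing_rTensor, sub_eq_zero, ← hωC, character_eq_sum]
    simp only [w, map_sum, evalPairing_tmul]
    rfl
  refine sub_eq_zero.1 ?_
  -- Embedding `Y⋆` as coordinate `0` of `(Y⋆)^ℕ` makes `eq_zero_of_evalPairing` applicable.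
  have hinj : Function.Injective
      ((LinearMap.single R (fun _ : ℕ ↦ CharacterModule Y) 0).lTensor (ℕ →₀ R)) :=
    Module.Flat.lTensor_preserves_injective_linearMap _
      (Pi.single_injective (M := fun _ : ℕ ↦ CharacterModule Y) 0)
  refine hinj ?_
  rw [map_zero]
  refine eq_zero_of_evalPairing fun f l ↦ ?_
  rw [← LinearMap.comp_apply, ← LinearMap.lTensor_comp]
  obtain rfl | hl0 := eq_or_ne l 0
  · rw [LinearMap.proj_comp_single_same, LinearMap.lTensor_id, LinearMap.id_apply, hpair]
  · rw [LinearMap.proj_comp_single_ne _ _ _ _ hl0, LinearMap.lTensor_zero,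
      LinearMap.zero_apply, map_zero]

lemma TensorExact.of_leftInverse {A B : Type u} [AddCommGroup A] [AddCommGroup B] [Module R A]
    [Module R B] {α : A →ₗ[R] B} {β : B →ₗ[R] A} (h : β ∘ₗ α = .id) {i : ℕ}
    (hB : TensorExact d i B) : TensorExact d i A := by
  have hβα : ∀ x, β.lTensor (ℕ →₀ R) (α.lTensor _ x) = x := fun x ↦ by
    rw [← LinearMap.comp_apply, ← LinearMap.lTensor_comp, h, LinearMap.lTensor_id,
      LinearMap.id_apply]
  intro c
  constructor
  · intro hc
    obtain ⟨w, hw⟩ := (hB (α.lTensor _ c)).1 (by rw [rTensor_lTensor_comm, hc, map_zero])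
    exact ⟨β.lTensor _ w, by rw [rTensor_lTensor_comm, hw, hβα]⟩
  · rintro ⟨w, rfl⟩
    rw [← hβα ((d i).rTensor A _), ← rTensor_lTensor_comm (d i) α,
      ← rTensor_lTensor_comm (d (i + 1)) α, (hB _).2 ⟨_, rfl⟩, map_zero]

/-- An injective module is a direct summand of the character module of a free module. -/
lemma exists_retract_characterModule (E : Type u) [AddCommGroup E] [Module R E]
    [hE : Module.Injective R E] :
    ∃ (α : E →ₗ[R] CharacterModule (CharacterModule E →₀ R))
      (β : CharacterModule (CharacterModule E →₀ R) →ₗ[R] E), β ∘ₗ α = .id := by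
  let p : (CharacterModule E →₀ R) →ₗ[R] CharacterModule E := Finsupp.linearCombination R id
  have hp : Function.Surjective p := Finsupp.linearCombination_id_surjective R _
  let ev : E →ₗ[R] CharacterModule (CharacterModule E) :=
    { toFun := fun x ↦
        { toFun := fun χ ↦ χ x
          map_zero' := rfl
          map_add' := fun _ _ ↦ rfl }
      map_add' := fun x y ↦ by ext χ; exact map_add χ x y
      map_smul' := fun r x ↦ rfl }
  have hev : Function.Injective ev := by
    refine (injective_iff_map_eq_zero ev).2 fun x hx ↦ ?_
    exact CharacterModule.eq_zero_of_character_apply fun χ ↦ DFunLike.congr_fun hx χ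
  obtain ⟨β, hβ⟩ := hE.out (CharacterModule.dual p ∘ₗ ev)
    ((CharacterModule.dual_injective_of_surjective p hp).comp hev) .id
  exact ⟨_, β, LinearMap.ext hβ⟩

/-- If `Ext` against free modules vanishes in high degrees, then so does `Tor` against
injective modules. -/
lemma tensorExact_of_homExact_free (hd : ∀ i, Function.Exact (d (i + 1)) (d i)) {i : ℕ}
    (h : ∀ (X : Type u) [AddCommGroup X] [Module R X] [Module.Projective R X], HomExact d i X)
    (h' : ∀ (X : Type u) [AddCommGroup X] [Module R X] [Module.Projective R X],
      HomExact d (i + 1) X)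
    (E : Type u) [AddCommGroup E] [Module R E] [Module.Injective R E] : TensorExact d i E := by
  obtain ⟨α, β, hαβ⟩ := exists_retract_characterModule (R := R) E
  exact .of_leftInverse hαβ (.of_proZero hd (.of_homExact hd (h _) (h' _)))

/-- If `Tor` against injective modules vanishes in high degrees, then so does `Ext` against
flat modules. -/
lemma homExact_of_tensorExact_injective (hd : ∀ i, Function.Exact (d (i + 1)) (d i)) {i : ℕ}
    (h : ∀ (E : Type u) [AddCommGroup E] [Module R E] [Module.Injective R E], TensorExact d i E)
    (h' : ∀ (E : Type u) [AddCommGroup E] [Module R E] [Module.Injective R E],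
      TensorExact d (i + 1) E)
    (Y : Type u) [AddCommGroup Y] [Module R Y] [Module.Flat R Y] : HomExact d (i + 1) Y := by
  -- The hypotheses are used for the countable power of `Y⋆`, injective as a product of injectives.
  have : Module.Injective R (CharacterModule Y) :=
    Module.Flat.iff_characterModule_injective.1 ‹_›
  exact .of_proZero hd (.of_tensorExact (h _)) (.of_tensorExact (h' _))

lemma homExact_of_forall_tensorExact (hd : ∀ i, Function.Exact (d (i + 1)) (d i)) {i : ℕ}
    (h : ∀ (N : Type u) [AddCommGroup N] [Module R N], TensorExact d i N)
    (h' : ∀ (N : Type u) [AddCommGroup N] [Module R N], TensorExact d (i + 1) N)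
    (Y : Type u) [AddCommGroup Y] [Module R Y] : HomExact d (i + 1) Y :=
  .of_proZero hd (.of_tensorExact (h _)) (.of_tensorExact (h' _))

end Duality

/-! ### Resolutions by `R^(ℕ)` and ideal tests for injectivity and flatness. -/

section Resolutions

variable {R : Type u} [CommRing R]

/-- A submodule with a countable set of generators. -/
def Submodule.CountablyGenerated {M : Type*} [AddCommGroup M] [Module R M] (N : Submodule R M) :
    Prop :=
  ∃ S : Set M, S.Countable ∧ Submodule.span R S = N

lemma Submodule.CountablyGenerated.exists_range_eq {M : Type*} [AddCommGroup M] [Module R M]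
    {N : Submodule R M} (h : N.CountablyGenerated) :
    ∃ f : (ℕ →₀ R) →ₗ[R] M, LinearMap.range f = N := by
  obtain ⟨S, hS, rfl⟩ := h
  obtain ⟨x, hx⟩ := (hS.insert 0).exists_eq_range (Set.insert_nonempty 0 S)
  refine ⟨Finsupp.linearCombination R x, ?_⟩
  rw [Finsupp.range_linearCombination, ← hx, Submodule.span_insert_zero]

/-- Filter `N` by the last nonzero coordinate: the `n`-th coefficients of its vectors supported
below `n + 1` form an ideal, and lifts of countable generators of these ideals generate `N`. -/
lemma IsAlephZeroNoetherian.countablyGenerated_finsupp (hR : IsAlephZeroNoetherian R)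
    (N : Submodule R (ℕ →₀ R)) : N.CountablyGenerated := by
  let N' : ℕ → Submodule R (ℕ →₀ R) := fun n ↦ N ⊓ Finsupp.supported R R (Set.Iio n)
  choose S hS hSI using fun n ↦ hR ((N' (n + 1)).map (Finsupp.lapply n))
  have hlift : ∀ n, ∀ a ∈ S n, ∃ x ∈ N' (n + 1), x n = a := fun n a ha ↦ by
    have : a ∈ (N' (n + 1)).map (Finsupp.lapply n) := by
      rw [← hSI n]; exact Ideal.subset_span ha
    simpa using! this
  choose! x hxN hxa using hlift
  refine ⟨⋃ n, x n '' S n, Set.countable_iUnion fun n ↦ (hS n).image _, le_antisymm ?_ ?_⟩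
  · rw [Submodule.span_le]
    rintro _ hy
    obtain ⟨n, a, ha, rfl⟩ := Set.mem_iUnion.1 hy
    exact (hxN n a ha).1
  · have key : ∀ n, N' n ≤ Submodule.span R (⋃ n, x n '' S n) := by
      intro n
      induction n with
      | zero =>
        rintro y ⟨-, hy⟩
        have : y = 0 := by
          ext j
          by_contra hne
          exact absurd (hy (Finsupp.mem_support_iff.2 hne)) (by simp)
        simp [this]
      | succ n ih =>
        intro y hy
        have h1 : (N' (n + 1)).map (Finsupp.lapply n) ≤
            ((N' (n + 1) ⊓ Submodule.span R (⋃ n, x n '' S n)).map (Finsupp.lapply n) :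
              Submodule R R) := by
          rw [← hSI n]
          refine Submodule.span_le.2 fun a ha ↦ ?_
          exact ⟨x n a, ⟨hxN n a ha, Submodule.subset_span
            (Set.mem_iUnion.2 ⟨n, a, ha, rfl⟩)⟩, hxa n a ha⟩
        obtain ⟨z, ⟨hzN, hzS⟩, hz⟩ := h1 ⟨y, hy, rfl⟩
        have hyz : y - z ∈ N' n := by
          refine ⟨(N' (n + 1)).sub_mem hy hzN |>.1, fun j hj ↦ ?_⟩
          have h2 := ((N' (n + 1)).sub_mem hy hzN).2 hj
          have h3 : j ≠ n := by
            rintro rfl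
            refine Finsupp.mem_support_iff.1 hj ?_
            rw [Finsupp.sub_apply, sub_eq_zero]
            exact hz.symm
          exact lt_of_le_of_ne (Nat.lt_succ_iff.1 h2) h3
        rw [← sub_add_cancel y z]
        exact Submodule.add_mem _ (ih hyz) hzS
    intro y hy
    refine key (y.support.sup id + 1) ⟨hy, fun j hj ↦ ?_⟩
    exact Nat.lt_succ_of_le (Finset.le_sup (f := id) hj)

/-- Any submodule of `R^(ℕ)` is the image of the first differential of an exact complex. -/
lemma IsAlephZeroNoetherian.exists_resolution (hR : IsAlephZeroNoetherian R)
    (K : Submodule R (ℕ →₀ R)) : ∃ d : ℕ → (ℕ →₀ R) →ₗ[R] (ℕ →₀ R),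
      LinearMap.range (d 0) = K ∧ ∀ i, Function.Exact (d (i + 1)) (d i) := by
  choose r hr using fun K ↦ (hR.countablyGenerated_finsupp K).exists_range_eq
  refine ⟨fun i ↦ Nat.rec (r K) (fun _ f ↦ r (LinearMap.ker f)) i, hr K, fun i ↦ ?_⟩
  rw [LinearMap.exact_iff]
  exact (hr _).symm

/-- The submodule of `R^(ℕ)` of vectors in `I` concentrated in the coordinate `0`. -/
noncomputable abbrev idealInFinsupp (I : Ideal R) : Submodule R (ℕ →₀ R) :=
  Submodule.map (Finsupp.lsingle 0) I

lemma exists_surjective_of_range_eq_idealInFinsupp {I : Ideal R}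
    {d₀ d₁ : (ℕ →₀ R) →ₗ[R] (ℕ →₀ R)} (hI : LinearMap.range d₀ = idealInFinsupp I)
    (hd : Function.Exact d₁ d₀) : ∃ q : (ℕ →₀ R) →ₗ[R] I, Function.Surjective q ∧
      Finsupp.lsingle 0 ∘ₗ I.subtype ∘ₗ q = d₀ ∧ q ∘ₗ d₁ = 0 := by
  have hinj : Function.Injective (Finsupp.lsingle 0 ∘ₗ I.subtype : I →ₗ[R] (ℕ →₀ R)) :=
    (Finsupp.single_injective 0).comp I.subtype_injective
  obtain ⟨q, hq⟩ := exists_comp_of_range_le hinj d₀ (fun x ↦ by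
    have hx : d₀ x ∈ idealInFinsupp I := hI ▸ LinearMap.mem_range_self d₀ x
    rwa [LinearMap.range_comp, Submodule.range_subtype])
  refine ⟨q, fun a ↦ ?_, hq, ?_⟩
  · have ha : Finsupp.single 0 (a : R) ∈ LinearMap.range d₀ := by
      rw [hI]
      exact ⟨a, a.2, rfl⟩
    obtain ⟨x, hx⟩ := ha
    exact ⟨x, hinj ((LinearMap.congr_fun hq x).trans hx)⟩
  · refine LinearMap.ext fun x ↦ hinj ?_
    refine (LinearMap.congr_fun hq (d₁ x)).trans ?_
    rw [hd.apply_linearMap_eq_zero, LinearMap.zero_apply, map_zero]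

/-- The cokernel of `d 0` is `R/I` plus a free module, so this is Baer's criterion in the form
`Ext¹(R/I, Y) = 0`. -/
lemma injective_of_homExact {Y : Type u} [AddCommGroup Y] [Module R Y]
    (h : ∀ I : Ideal R, ∃ d : ℕ → (ℕ →₀ R) →ₗ[R] (ℕ →₀ R),
      LinearMap.range (d 0) = idealInFinsupp I ∧ (∀ i, Function.Exact (d (i + 1)) (d i)) ∧
      HomExact d 0 Y) : Module.Injective R Y := by
  refine Module.Baer.injective fun I φ ↦ ?_
  obtain ⟨d, hdI, hd, hY⟩ := h I
  obtain ⟨q, hq, hcomp, hqd⟩ := exists_surjective_of_range_eq_idealInFinsupp hdI (hd 0)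
  obtain ⟨g, hg⟩ := hY (φ ∘ₗ q) (by rw [LinearMap.comp_assoc, hqd, LinearMap.comp_zero])
  refine ⟨g ∘ₗ Finsupp.lsingle 0, fun a ha ↦ ?_⟩
  obtain ⟨x, hx⟩ := hq ⟨a, ha⟩
  have h1 := LinearMap.congr_fun hg x
  have h2 := LinearMap.congr_fun hcomp x
  simp only [LinearMap.comp_apply, hx] at h1 h2
  rw [← h2] at h1
  exact h1

lemma flat_of_tensorExact {N : Type u} [AddCommGroup N] [Module R N]
    (h : ∀ I : Ideal R, ∃ d : ℕ → (ℕ →₀ R) →ₗ[R] (ℕ →₀ R),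
      LinearMap.range (d 0) = idealInFinsupp I ∧ (∀ i, Function.Exact (d (i + 1)) (d i)) ∧
      TensorExact d 0 N) : Module.Flat R N := by
  refine Module.Flat.iff_rTensor_injective'.2 fun I ↦ ?_
  obtain ⟨d, hdI, hd, hN⟩ := h I
  obtain ⟨q, hq, hcomp, hqd⟩ := exists_surjective_of_range_eq_idealInFinsupp hdI (hd 0)
  refine (injective_iff_map_eq_zero _).2 fun z hz ↦ ?_
  obtain ⟨z, rfl⟩ := LinearMap.rTensor_surjective N hq z
  obtain ⟨w, rfl⟩ := (hN z).1 (by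
    rw [← hcomp, LinearMap.rTensor_comp, LinearMap.rTensor_comp, LinearMap.comp_apply,
      LinearMap.comp_apply, hz, map_zero])
  rw [← LinearMap.comp_apply, ← LinearMap.rTensor_comp, hqd, LinearMap.rTensor_zero,
    LinearMap.zero_apply]

end Resolutions

/-! ### Homological dimensions through syzygies and cosyzygies. -/

section Dimensions

variable {R : Type u} [CommRing R] {d : ℕ → (ℕ →₀ R) →ₗ[R] (ℕ →₀ R)}

section ShortExact

variable {A B C : Type u} [AddCommGroup A] [AddCommGroup B] [AddCommGroup C]
  [Module R A] [Module R B] [Module R C]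

/-- The short complex of modules given by a pair of linear maps. -/
abbrev moduleShortComplex {α : A →ₗ[R] B} {β : B →ₗ[R] C} (h : Function.Exact α β) :
    ShortComplex (ModuleCat.{u} R) :=
  .mk (ModuleCat.ofHom α) (ModuleCat.ofHom β) (by
    rw [← ModuleCat.ofHom_comp, h.linearMap_comp_eq_zero, ModuleCat.ofHom_zero])

lemma shortExact_moduleShortComplex {α : A →ₗ[R] B} {β : B →ₗ[R] C} (h : Function.Exact α β)
    (hα : Function.Injective α) (hβ : Function.Surjective β) :
    (moduleShortComplex h).ShortExact where
  exact := (ShortComplex.ShortExact.moduleCat_exact_iff_function_exact _).2 h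
  mono_f := (ModuleCat.mono_iff_injective _).2 hα
  epi_g := (ModuleCat.epi_iff_surjective _).2 hβ

variable (R) in
lemma exists_injective_presentation (A : Type u) [AddCommGroup A] [Module R A] :
    ∃ (J : Type u) (_ : AddCommGroup J) (_ : Module R J) (C : Type u) (_ : AddCommGroup C)
      (_ : Module R C) (α : A →ₗ[R] J) (β : J →ₗ[R] C), Module.Injective R J ∧
      Function.Injective α ∧ Function.Surjective β ∧ Function.Exact α β := by
  let p := (EnoughInjectives.presentation (ModuleCat.of R A)).some
  have : Injective (ModuleCat.of R p.J) := p.injective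
  exact ⟨p.J, inferInstance, inferInstance, p.J ⧸ LinearMap.range p.f.hom, inferInstance,
    inferInstance, p.f.hom, (LinearMap.range p.f.hom).mkQ,
    Module.injective_module_of_injective_object R p.J,
    (ModuleCat.mono_iff_injective _).1 p.mono, Submodule.mkQ_surjective _,
    LinearMap.exact_map_mkQ_range _⟩

variable (R) in
lemma exists_projective_presentation (A : Type u) [AddCommGroup A] [Module R A] :
    ∃ (Q : Type u) (_ : AddCommGroup Q) (_ : Module R Q) (K : Type u) (_ : AddCommGroup K)
      (_ : Module R K) (α : K →ₗ[R] Q) (β : Q →ₗ[R] A), Module.Projective R Q ∧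
      Function.Injective α ∧ Function.Surjective β ∧ Function.Exact α β :=
  ⟨A →₀ R, inferInstance, inferInstance, LinearMap.ker (Finsupp.linearCombination R (id : A → A)),
    inferInstance, inferInstance, (LinearMap.ker _).subtype, Finsupp.linearCombination R id,
    inferInstance, Submodule.subtype_injective _, Finsupp.linearCombination_id_surjective R A,
    LinearMap.exact_subtype_ker_map _⟩

lemma hasInjectiveDimensionLT_one_iff :
    HasInjectiveDimensionLT (ModuleCat.of R A) 1 ↔ Module.Injective R A := by
  rw [← injective_iff_hasInjectiveDimensionLT_one, Module.injective_iff_injective_object]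

lemma hasProjectiveDimensionLT_one_iff :
    HasProjectiveDimensionLT (ModuleCat.of R A) 1 ↔ Module.Projective R A := by
  rw [← projective_iff_hasProjectiveDimensionLT_one, IsProjective.iff_projective]

lemma hasInjectiveDimensionLT_iff_of_exact {α : A →ₗ[R] B} {β : B →ₗ[R] C}
    (h : Function.Exact α β) (hα : Function.Injective α) (hβ : Function.Surjective β)
    [Module.Injective R B] (n : ℕ) : HasInjectiveDimensionLT (ModuleCat.of R A) (n + 2) ↔
      HasInjectiveDimensionLT (ModuleCat.of R C) (n + 1) :=
  ((shortExact_moduleShortComplex h hα hβ).hasInjectiveDimensionLT_X₃_iff n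
    (Module.injective_object_of_injective_module R B)).symm

lemma hasProjectiveDimensionLT_iff_of_exact {α : A →ₗ[R] B} {β : B →ₗ[R] C}
    (h : Function.Exact α β) (hα : Function.Injective α) (hβ : Function.Surjective β)
    [Module.Projective R B] (n : ℕ) : HasProjectiveDimensionLT (ModuleCat.of R C) (n + 2) ↔
      HasProjectiveDimensionLT (ModuleCat.of R A) (n + 1) :=
  (shortExact_moduleShortComplex h hα hβ).hasProjectiveDimensionLT_X₃_iff n
    ((IsProjective.iff_projective B).1 ‹_›)

end ShortExact

lemma homExact_of_hasInjectiveDimensionLT (hd : ∀ i, Function.Exact (d (i + 1)) (d i)) (n : ℕ)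
    (Y : Type u) [AddCommGroup Y] [Module R Y]
    (hY : HasInjectiveDimensionLT (ModuleCat.of R Y) (n + 1)) (i : ℕ) (hi : n ≤ i) :
    HomExact d i Y := by
  induction n generalizing Y i with
  | zero =>
    have := hasInjectiveDimensionLT_one_iff.1 hY
    exact homExact_of_injective hd i
  | succ n ih =>
    obtain ⟨J, _, _, C, _, _, α, β, _, hα, hβ, h⟩ := exists_injective_presentation R Y
    obtain ⟨i, rfl⟩ := Nat.exists_eq_add_of_le' hi
    exact (ih C ((hasInjectiveDimensionLT_iff_of_exact h hα hβ n).1 hY) (i + n)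
      (Nat.le_add_left _ _)).succ_of_shortExact hd hα hβ h

lemma hasInjectiveDimensionLT_of_homExact {d : Ideal R → ℕ → (ℕ →₀ R) →ₗ[R] (ℕ →₀ R)}
    (hdI : ∀ I, LinearMap.range (d I 0) = idealInFinsupp I)
    (hd : ∀ I i, Function.Exact (d I (i + 1)) (d I i)) (n : ℕ)
    (Y : Type u) [AddCommGroup Y] [Module R Y] (hY : ∀ I, HomExact (d I) n Y) :
    HasInjectiveDimensionLT (ModuleCat.of R Y) (n + 1) := by
  induction n generalizing Y with
  | zero =>
    exact hasInjectiveDimensionLT_one_iff.2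
      (injective_of_homExact fun I ↦ ⟨d I, hdI I, hd I, hY I⟩)
  | succ n ih =>
    obtain ⟨J, _, _, C, _, _, α, β, _, hα, hβ, h⟩ := exists_injective_presentation R Y
    exact (hasInjectiveDimensionLT_iff_of_exact h hα hβ n).2
      (ih C fun I ↦ (hY I).of_succ_of_shortExact (hd I) hα hβ h)

lemma tensorExact_of_hasProjectiveDimensionLT (hd : ∀ i, Function.Exact (d (i + 1)) (d i))
    (n : ℕ) (N : Type u) [AddCommGroup N] [Module R N]
    (hN : HasProjectiveDimensionLT (ModuleCat.of R N) (n + 1)) (i : ℕ) (hi : n ≤ i) :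
    TensorExact d i N := by
  induction n generalizing N i with
  | zero =>
    have := hasProjectiveDimensionLT_one_iff.1 hN
    exact tensorExact_of_flat hd i
  | succ n ih =>
    obtain ⟨Q, _, _, K, _, _, α, β, _, hα, hβ, h⟩ := exists_projective_presentation R N
    obtain ⟨i, rfl⟩ := Nat.exists_eq_add_of_le' hi
    exact (ih K ((hasProjectiveDimensionLT_iff_of_exact h hα hβ n).1 hN) (i + n)
      (Nat.le_add_left _ _)).succ_of_shortExact hd hα hβ h

/-- The `n`-th syzygy of `N` is flat by the ideal criterion, so `n` projective steps are followed by
at most `m` more. -/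
lemma hasProjectiveDimensionLT_of_tensorExact {d : Ideal R → ℕ → (ℕ →₀ R) →ₗ[R] (ℕ →₀ R)}
    (hdI : ∀ I, LinearMap.range (d I 0) = idealInFinsupp I)
    (hd : ∀ I i, Function.Exact (d I (i + 1)) (d I i)) {m : ℕ}
    (hm : ∀ (F : Type u) [AddCommGroup F] [Module R F] [Module.Flat R F],
      HasProjectiveDimensionLT (ModuleCat.of R F) (m + 1)) (n : ℕ)
    (N : Type u) [AddCommGroup N] [Module R N] (hN : ∀ I, TensorExact (d I) n N) :
    HasProjectiveDimensionLT (ModuleCat.of R N) (n + m + 1) := by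
  induction n generalizing N with
  | zero =>
    have := flat_of_tensorExact fun I ↦ ⟨d I, hdI I, hd I, hN I⟩
    simpa using hm N
  | succ n ih =>
    obtain ⟨Q, _, _, K, _, _, α, β, _, hα, hβ, h⟩ := exists_projective_presentation R N
    rw [add_right_comm n 1 m]
    exact (hasProjectiveDimensionLT_iff_of_exact h hα hβ (n + m)).2
      (ih K fun I ↦ (hN I).of_succ_of_shortExact (hd I) hα hβ h)

/-! ### Countably generated flat modules -/

/-- This is the balance of `Tor`: in the lowest degree, flatness of `M` is used to keep `M ⊗ K → M ⊗
Q` injective; the higher degrees follow by shifting. -/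
lemma tensorExact_of_flat_quotient (hd : ∀ i, Function.Exact (d (i + 1)) (d i))
    {M : Type u} [AddCommGroup M] [Module R M] [Module.Flat R M] {p : (ℕ →₀ R) →ₗ[R] M}
    (hp : Function.Surjective p) (hdp : Function.Exact (d 0) p) (i : ℕ)
    (N : Type u) [AddCommGroup N] [Module R N] : TensorExact d i N := by
  induction i generalizing N with
  | succ i ih =>
    obtain ⟨Q, _, _, K, _, _, α, β, _, hα, hβ, h⟩ := exists_projective_presentation R N
    exact (ih K).succ_of_shortExact hd hα hβ h
  | zero =>
    obtain ⟨Q, _, _, K, _, _, α, β, _, hα, hβ, h⟩ := exists_projective_presentation R N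
    have hzero : (d 0).rTensor N ∘ₗ (d 1).rTensor N = 0 := by
      rw [← LinearMap.rTensor_comp, (hd 0).linearMap_comp_eq_zero, LinearMap.rTensor_zero]
    have hex := Module.Flat.lTensor_exact (ℕ →₀ R) h
    have hexd := rTensor_exact K hdp hp
    intro c
    refine ⟨fun hc ↦ ?_, fun ⟨w, hw⟩ ↦ hw ▸ LinearMap.congr_fun hzero w⟩
    obtain ⟨c, rfl⟩ := LinearMap.lTensor_surjective (ℕ →₀ R) hβ c
    rw [rTensor_lTensor_comm] at hc
    obtain ⟨u, hu⟩ := (hex _).1 hc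
    have hu0 : p.rTensor K u = 0 := by
      refine Module.Flat.lTensor_preserves_injective_linearMap (M := M) α hα ?_
      rw [map_zero, ← rTensor_lTensor_comm, hu, ← LinearMap.comp_apply, ← LinearMap.rTensor_comp,
        hdp.linearMap_comp_eq_zero, LinearMap.rTensor_zero, LinearMap.zero_apply]
    obtain ⟨v, rfl⟩ := (hexd _).1 hu0
    obtain ⟨w, hw⟩ := (tensorExact_of_flat (A := Q) hd 0 (c - α.lTensor _ v)).1 (by
      rw [map_sub, rTensor_lTensor_comm, hu, sub_self])
    refine ⟨β.lTensor _ w, ?_⟩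
    have hv : β.lTensor (ℕ →₀ R) (α.lTensor _ v) = 0 := hex.apply_apply_eq_zero v
    rw [rTensor_lTensor_comm, hw, map_sub, hv]
    exact sub_zero (β.lTensor (ℕ →₀ R) c)

/-- Applied to the universal cocycle `d 1` onto its range, the hypothesis gives a retraction onto
the kernel of `d 0`, which splits `d 0` onto its range. -/
lemma projective_range_of_homExact (hd : ∀ i, Function.Exact (d (i + 1)) (d i))
    (h : ∀ (Y : Type u) [AddCommGroup Y] [Module R Y], HomExact d 1 Y) :
    Module.Projective R (LinearMap.range (d 0)) := by
  obtain ⟨g, hg⟩ := h (LinearMap.range (d 1)) (d 1).rangeRestrict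
    (LinearMap.ext fun x ↦ Subtype.ext ((hd 1).apply_linearMap_eq_zero x))
  obtain ⟨s, hs⟩ := (hd 0).exists_factor (.id - (LinearMap.range (d 1)).subtype ∘ₗ g) (by
    refine LinearMap.ext fun x ↦ ?_
    have := congrArg Subtype.val (LinearMap.congr_fun hg x)
    simpa [sub_eq_zero] using this.symm)
  refine Module.Projective.of_split s (d 0).rangeRestrict ?_
  refine LinearMap.ext fun ⟨_, x, hx⟩ ↦ Subtype.ext ?_
  subst hx
  have h1 := LinearMap.congr_fun hs x
  obtain ⟨y, hy⟩ := (g x).2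
  have h2 : d 0 (g x : ℕ →₀ R) = 0 := by
    rw [← hy]; exact (hd 0).apply_linearMap_eq_zero y
  have h3 : d 0 (s ((d 0).rangeRestrict x)) = d 0 x := by
    simpa [h2] using congrArg (d 0) h1
  exact h3

lemma hasProjectiveDimensionLT_two_of_flat (hR : IsAlephZeroNoetherian R)
    (M : Type u) [AddCommGroup M] [Module R M] [Module.Flat R M]
    (hM : (⊤ : Submodule R M).CountablyGenerated) :
    HasProjectiveDimensionLT (ModuleCat.of R M) 2 := by
  obtain ⟨p, hp⟩ := hM.exists_range_eq
  rw [LinearMap.range_eq_top] at hp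
  obtain ⟨d, hd0, hd⟩ := hR.exists_resolution (LinearMap.ker p)
  have hdp : Function.Exact (d 0) p := LinearMap.exact_iff.2 hd0.symm
  have hT := tensorExact_of_flat_quotient hd hp hdp
  have := projective_range_of_homExact hd fun Y _ _ ↦
    homExact_of_forall_tensorExact hd (i := 0) (fun N _ _ ↦ hT 0 N) (fun N _ _ ↦ hT 1 N) Y
  rw [hd0] at this
  exact (hasProjectiveDimensionLT_iff_of_exact (LinearMap.exact_subtype_ker_map p)
    (Submodule.subtype_injective _) hp 0).2 (hasProjectiveDimensionLT_one_iff.2 this)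

/-! ### Bounding finite dimensions -/

/-- In the top degree, `Ext(M, -)` is right exact, so a projective cover `Q → Y` by any surjection
makes `Ext(M, Y)` a quotient of `Ext(M, Q)`, which vanishes above degree `n`. -/
lemma hasProjectiveDimensionLT_of_finite {n : ℕ}
    (hn : ∀ (P : Type u) [AddCommGroup P] [Module R P] [Module.Projective R P],
      HasInjectiveDimensionLT (ModuleCat.of R P) (n + 1))
    (M : ModuleCat.{u} R) (k : ℕ) (hM : HasProjectiveDimensionLT M (n + 1 + k)) :
    HasProjectiveDimensionLT M (n + 1) := by
  induction k with
  | zero => exact hM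
  | succ k ih =>
    refine ih (hasProjectiveDimensionLT_of_enoughInjectives M _ fun Y ↦ ⟨?_⟩)
    suffices ∀ e : Ext M Y (n + 1 + k), e = 0 from fun a b ↦ (this a).trans (this b).symm
    intro e
    obtain ⟨Q, _, _, K, _, _, α, β, _, hα, hβ, h⟩ := exists_projective_presentation R Y
    obtain ⟨x, rfl⟩ := Ext.covariant_sequence_exact₃ M (shortExact_moduleShortComplex h hα hβ) e
      rfl (Ext.eq_zero_of_hasProjectiveDimensionLT _ (n + 1 + (k + 1)) le_rfl)
    have := hn Q
    rw [Ext.eq_zero_of_hasInjectiveDimensionLT x (n + 1) (Nat.le_add_right _ _), Ext.zero_comp]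

lemma hasInjectiveDimensionLT_of_finite {n : ℕ}
    (hn : ∀ (E : Type u) [AddCommGroup E] [Module R E] [Module.Injective R E],
      HasProjectiveDimensionLT (ModuleCat.of R E) (n + 1))
    (M : ModuleCat.{u} R) (k : ℕ) (hM : HasInjectiveDimensionLT M (n + 1 + k)) :
    HasInjectiveDimensionLT M (n + 1) := by
  induction k with
  | zero => exact hM
  | succ k ih =>
    refine ih (hasInjectiveDimensionLT_of_enoughProjectives M _ fun Y ↦ ⟨?_⟩)
    suffices ∀ e : Ext Y M (n + 1 + k), e = 0 from fun a b ↦ (this a).trans (this b).symm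
    intro e
    obtain ⟨J, _, _, C, _, _, α, β, _, hα, hβ, h⟩ := exists_injective_presentation R Y
    obtain ⟨x, rfl⟩ := Ext.contravariant_sequence_exact₁ (shortExact_moduleShortComplex h hα hβ)
      M e (add_comm 1 _)
      (Ext.eq_zero_of_hasInjectiveDimensionLT _ (n + 1 + (k + 1)) le_rfl)
    have := hn J
    rw [Ext.eq_zero_of_hasProjectiveDimensionLT x (n + 1) (Nat.le_add_right _ _), Ext.comp_zero]

/-! ### Vanishing of `Ext` as a lifting property -/

/-- Every linear map from `M` to the target of `π` lifts along `π`. -/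
def LiftsAlong (M : Type u) [AddCommGroup M] [Module R M] {J Z : Type u} [AddCommGroup J]
    [AddCommGroup Z] [Module R J] [Module R Z] (π : J →ₗ[R] Z) : Prop :=
  ∀ φ : M →ₗ[R] Z, ∃ ψ : M →ₗ[R] J, π ∘ₗ ψ = φ

/-- Shift `Ext^{n+1}` to `Ext¹` along an injective resolution of `Y`. One `π` serves all `M`, so
filtration arguments need only lifts. -/
lemma exists_liftsAlong_iff (n : ℕ) (Y : Type u) [AddCommGroup Y] [Module R Y] :
    ∃ (J : Type u) (_ : AddCommGroup J) (_ : Module R J) (Z : Type u) (_ : AddCommGroup Z)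
      (_ : Module R Z) (π : J →ₗ[R] Z), Module.Injective R J ∧
      ∀ (M : Type u) [AddCommGroup M] [Module R M], LiftsAlong M π ↔
        ∀ e : Ext (ModuleCat.of R M) (ModuleCat.of R Y) (n + 1), e = 0 := by
  induction n generalizing Y with
  | zero =>
    obtain ⟨J, _, _, C, _, _, α, β, hJ, hα, hβ, h⟩ := exists_injective_presentation R Y
    refine ⟨J, _, _, C, _, _, β, hJ, fun M _ _ ↦ ?_⟩
    have hS := shortExact_moduleShortComplex h hα hβ
    have : Injective (ModuleCat.of R J) := Module.injective_object_of_injective_module R J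
    constructor
    · intro hM e
      obtain ⟨x, rfl⟩ := Ext.covariant_sequence_exact₁ (ModuleCat.of R M) hS e
        (Ext.eq_zero_of_injective _) rfl
      obtain ⟨φ, rfl⟩ := Ext.homEquiv₀.symm.surjective x
      obtain ⟨ψ, hψ⟩ := hM φ.hom
      have : φ = ModuleCat.ofHom ψ ≫ (moduleShortComplex h).g := by
        ext x
        exact (LinearMap.congr_fun hψ x).symm
      rw [Ext.homEquiv₀_symm_apply, this, ← Ext.mk₀_comp_mk₀, Ext.comp_assoc_of_second_deg_zero,
        hS.comp_extClass, Ext.comp_zero]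
    · intro hM φ
      obtain ⟨x, hx⟩ := Ext.covariant_sequence_exact₃ (ModuleCat.of R M) hS
        (Ext.mk₀ (ModuleCat.ofHom φ)) (zero_add 1) (hM _)
      obtain ⟨ψ, rfl⟩ := Ext.homEquiv₀.symm.surjective x
      refine ⟨ψ.hom, ?_⟩
      rw [Ext.homEquiv₀_symm_apply, Ext.mk₀_comp_mk₀] at hx
      have := Ext.homEquiv₀.symm.injective
        (a₁ := ψ ≫ (moduleShortComplex h).g) (a₂ := ModuleCat.ofHom φ) (by simpa using hx)
      exact congrArg ModuleCat.Hom.hom this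
  | succ n ih =>
    obtain ⟨J, _, _, C, _, _, α, β, hJ, hα, hβ, h⟩ := exists_injective_presentation R Y
    obtain ⟨J', _, _, Z, _, _, π, hJ', hπ⟩ := ih C
    refine ⟨J', _, _, Z, _, _, π, hJ', fun M _ _ ↦ (hπ M).trans ?_⟩
    have hS := shortExact_moduleShortComplex h hα hβ
    have : Injective (ModuleCat.of R J) := Module.injective_object_of_injective_module R J
    constructor
    · intro hM e
      obtain ⟨x, rfl⟩ := Ext.covariant_sequence_exact₁ (ModuleCat.of R M) hS e
        (Ext.eq_zero_of_injective _) rfl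
      rw [hM x, Ext.zero_comp]
    · intro hM e
      obtain ⟨x, rfl⟩ := Ext.covariant_sequence_exact₃ (ModuleCat.of R M) hS e rfl (hM _)
      have : x = 0 := Ext.eq_zero_of_injective x
      rw [this, Ext.zero_comp]

lemma hasProjectiveDimensionLT_of_liftsAlong (n : ℕ) (M : Type u) [AddCommGroup M] [Module R M]
    (h : ∀ (J Z : Type u) [AddCommGroup J] [AddCommGroup Z] [Module R J] [Module R Z]
      (π : J →ₗ[R] Z) [Module.Injective R J],
      (∀ (N : Type u) [AddCommGroup N] [Module R N],
        HasProjectiveDimensionLT (ModuleCat.of R N) (n + 1) → LiftsAlong N π) → LiftsAlong M π) :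
    HasProjectiveDimensionLT (ModuleCat.of R M) (n + 1) := by
  refine hasProjectiveDimensionLT_of_enoughInjectives _ _ fun Y ↦ ⟨?_⟩
  suffices ∀ e : Ext (ModuleCat.of R M) Y (n + 1), e = 0 from
    fun a b ↦ (this a).trans (this b).symm
  obtain ⟨J, _, _, Z, _, _, π, hJ, hπ⟩ := exists_liftsAlong_iff (R := R) n Y
  exact (hπ M).1 (h J Z π fun N _ _ hN ↦ (hπ N).2 fun e ↦
    Ext.eq_zero_of_hasProjectiveDimensionLT e (n + 1) le_rfl)

end Dimensions

/-! ### Eklof's lemma. -/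

section Filtration

variable {R : Type u} [CommRing R]

/-- Injectivity of `J` extends `f` to `E`; the error against `φ` vanishes on `D`, so it is a map
from `E/D`, whose lift corrects the extension. -/
lemma exists_lift_extension {F J Z : Type u} [AddCommGroup F] [AddCommGroup J] [AddCommGroup Z]
    [Module R F] [Module R J] [Module R Z] [hJ : Module.Injective R J] {π : J →ₗ[R] Z}
    {D E : Submodule R F} (hDE : D ≤ E) (hlift : LiftsAlong (E ⧸ D.submoduleOf E) π)
    (φ : F →ₗ[R] Z) (f : D →ₗ[R] J) (hf : ∀ x, π (f x) = φ x) :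
    ∃ g : E →ₗ[R] J, (∀ x, π (g x) = φ x) ∧ ∀ x, g (Submodule.inclusion hDE x) = f x := by
  obtain ⟨θ, hθ⟩ := hJ.out (Submodule.inclusion hDE) (Submodule.inclusion_injective hDE) f
  have hD : ∀ x (hx : x ∈ D), θ ⟨x, hDE hx⟩ = f ⟨x, hx⟩ := fun x hx ↦ hθ ⟨x, hx⟩
  obtain ⟨l, hl⟩ := hlift ((D.submoduleOf E).liftQ (φ ∘ₗ E.subtype - π ∘ₗ θ) (by
    rintro ⟨x, hxE⟩ hx
    have hxD : x ∈ D := hx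
    simp [hD x hxD, hf]))
  refine ⟨θ + l ∘ₗ (D.submoduleOf E).mkQ, fun x ↦ ?_, fun x ↦ ?_⟩
  · have := LinearMap.congr_fun hl ((D.submoduleOf E).mkQ x)
    simp only [LinearMap.comp_apply, Submodule.mkQ_apply, Submodule.liftQ_apply,
      LinearMap.sub_apply, Submodule.subtype_apply] at this
    simp [this]
  · have : (D.submoduleOf E).mkQ (Submodule.inclusion hDE x) = 0 := by
      rw [Submodule.mkQ_apply, Submodule.Quotient.mk_eq_zero]
      exact x.2
    rw [LinearMap.add_apply, LinearMap.comp_apply, this, map_zero, add_zero]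
    exact hθ x

/-- **Eklof's lemma**: maps out of the union of a continuous filtration lift along an epimorphism
with injective source if this is the case for the factors of the filtration. -/
lemma liftsAlong_of_filtration {F J Z : Type u} [AddCommGroup F] [AddCommGroup J] [AddCommGroup Z]
    [Module R F] [Module R J] [Module R Z] [Module.Injective R J] {π : J →ₗ[R] Z}
    {ι : Type*} [LinearOrder ι] [WellFoundedLT ι] {N : Set ι → Submodule R F} (hmono : Monotone N)
    (hcont : ∀ c : Set (Set ι), c.Nonempty → IsChain (· ⊆ ·) c → ∀ x ∈ N (⋃₀ c), ∃ U ∈ c, x ∈ N U)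
    (htop : N Set.univ = ⊤) (h0 : LiftsAlong (N ∅) π)
    (hstep : ∀ i, LiftsAlong (N (Set.Iic i) ⧸ (N (Set.Iio i)).submoduleOf (N (Set.Iic i))) π) :
    LiftsAlong F π := by
  intro φ
  have hchain : ∀ c : Set (Set ι), (∀ U ∈ c, IsLowerSet U) → IsChain (· ⊆ ·) c :=
    fun c hc U hU V hV _ ↦ (hc U hU).total (hc V hV)
  let S : Set (F →ₗ.[R] J) :=
    {p | (∃ U, IsLowerSet U ∧ N U = p.domain) ∧ ∀ x : p.domain, π (p x) = φ x}
  obtain ⟨f₀, hf₀⟩ := h0 (φ ∘ₗ (N ∅).subtype)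
  obtain ⟨p, -, hp⟩ := zorn_le_nonempty₀ S (fun c hcS hc y hy ↦ by
    have hne : c.Nonempty := ⟨y, hy⟩
    refine ⟨LinearPMap.sSup c hc.directedOn, ⟨?_, ?_⟩, fun z hz ↦ LinearPMap.le_sSup _ hz⟩
    · let c' : Set (Set ι) := {U | IsLowerSet U ∧ ∃ p ∈ c, N U = p.domain}
      have hc'ne : c'.Nonempty := by
        obtain ⟨U, hU, hUy⟩ := (hcS hy).1
        exact ⟨U, hU, y, hy, hUy⟩
      refine ⟨⋃₀ c', isLowerSet_sUnion fun U hU ↦ hU.1, le_antisymm (fun x hx ↦ ?_)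
        (fun x hx ↦ ?_)⟩
      · obtain ⟨U, ⟨-, p, hpc, hUp⟩, hxU⟩ := hcont c' hc'ne (hchain c' fun U hU ↦ hU.1) x hx
        exact (LinearPMap.mem_domain_sSup_iff hne hc.directedOn).2 ⟨p, hpc, hUp ▸ hxU⟩
      · obtain ⟨p, hpc, hxp⟩ := (LinearPMap.mem_domain_sSup_iff hne hc.directedOn).1 hx
        obtain ⟨U, hU, hUp⟩ := (hcS hpc).1
        exact hmono (Set.subset_sUnion_of_mem (show U ∈ c' from ⟨hU, p, hpc, hUp⟩))
          (hUp ▸ hxp)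
    · rintro ⟨x, hx⟩
      obtain ⟨p, hpc, hxp⟩ := (LinearPMap.mem_domain_sSup_iff hne hc.directedOn).1 hx
      exact (congrArg π (LinearPMap.sSup_apply hc.directedOn hpc ⟨x, hxp⟩)).trans
        ((hcS hpc).2 ⟨x, hxp⟩)) ⟨N ∅, f₀⟩
    ⟨⟨∅, isLowerSet_empty, rfl⟩, fun x ↦ LinearMap.congr_fun hf₀ x⟩
  obtain ⟨⟨U, hU, hUp⟩, hpφ⟩ := hp.prop
  -- Different lower sets may give the same submodule. Taking the largest one ensures that adding
  -- its least missing index strictly enlarges the domain.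
  let c : Set (Set ι) := {W | IsLowerSet W ∧ N W ≤ p.domain}
  have hVlower : IsLowerSet (⋃₀ c) := isLowerSet_sUnion fun W hW ↦ hW.1
  have hV : N (⋃₀ c) = p.domain := by
    refine le_antisymm (fun x hx ↦ ?_) (hUp ▸ hmono (Set.subset_sUnion_of_mem ⟨hU, hUp.le⟩))
    obtain ⟨W, hW, hxW⟩ := hcont c ⟨U, hU, hUp.le⟩ (hchain c fun W hW ↦ hW.1) x hx
    exact hW.2 hxW
  by_cases huniv : ⋃₀ c = Set.univ
  · rw [huniv, htop] at hV
    refine ⟨p.toFun ∘ₗ (LinearEquiv.ofTop _ hV.symm).symm.toLinearMap, LinearMap.ext fun x ↦ ?_⟩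
    exact hpφ _
  · exfalso
    have hne : ((⋃₀ c)ᶜ).Nonempty := Set.nonempty_compl.2 huniv
    let i := wellFounded_lt.min ((⋃₀ c)ᶜ) hne
    have hi : i ∉ ⋃₀ c := wellFounded_lt.min_mem _ hne
    have hVi : ⋃₀ c = Set.Iio i := by
      ext j
      refine ⟨fun hj ↦ ?_, fun hj ↦ ?_⟩
      · by_contra hji
        exact hi (hVlower (not_lt.1 hji) hj)
      · by_contra hjV
        exact wellFounded_lt.not_lt_min _ hjV hj
    rw [hVi] at hV
    have hle : N (Set.Iio i) ≤ N (Set.Iic i) := hmono Set.Iio_subset_Iic_self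
    obtain ⟨g, hg, hgf⟩ := exists_lift_extension hle (hstep i) φ
      (p.toFun ∘ₗ Submodule.inclusion hV.le) fun x ↦ hpφ _
    have hmem : (⟨N (Set.Iic i), g⟩ : F →ₗ.[R] J) ∈ S :=
      ⟨⟨_, isLowerSet_Iic i, rfl⟩, hg⟩
    have hdom := (hp.le_of_ge hmem ⟨hV.ge.trans hle, fun x y hxy ↦ by
      obtain rfl : Submodule.inclusion hle ⟨x, hV.ge x.2⟩ = y := Subtype.ext hxy
      exact (hgf ⟨x, hV.ge x.2⟩).symm⟩).1
    exact hi (Set.mem_sUnion.2 ⟨Set.Iic i, ⟨isLowerSet_Iic i, hdom⟩, le_rfl⟩)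

end Filtration

/-! ### Flat submodules with few generators, and projective dimension of flat modules. -/

section FlatSubmodules

variable {R : Type u} [CommRing R]

lemma Submodule.CountablyGenerated.map {M M' : Type*} [AddCommGroup M] [AddCommGroup M']
    [Module R M] [Module R M'] {N : Submodule R M} (h : N.CountablyGenerated) (f : M →ₗ[R] M') :
    (N.map f).CountablyGenerated := by
  obtain ⟨S, hS, rfl⟩ := h
  exact ⟨f '' S, hS.image f, Submodule.span_image f⟩

lemma IsAlephZeroNoetherian.exists_span_range_eq (hR : IsAlephZeroNoetherian R) {l : ℕ}
    (K : Submodule R (Fin l →₀ R)) :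
    ∃ g : ℕ → (Fin l →₀ R), Submodule.span R (Set.range g) = K := by
  let e : (Fin l →₀ R) →ₗ[R] (ℕ →₀ R) := Finsupp.lmapDomain R R Fin.val
  let r : (ℕ →₀ R) →ₗ[R] (Fin l →₀ R) :=
    Finsupp.linearCombination R fun j ↦ if h : j < l then Finsupp.single ⟨j, h⟩ 1 else 0
  have hre : r ∘ₗ e = .id := by
    ext1 j
    ext1
    simp [r, e]
  obtain ⟨f, hf⟩ := ((hR.countablyGenerated_finsupp (K.map e)).map r).exists_range_eq
  refine ⟨fun j ↦ f (Finsupp.single j 1), ?_⟩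
  rw [← Submodule.map_comp, hre, Submodule.map_id] at hf
  rw [← hf, ← Finsupp.range_linearCombination]
  congr 1
  ext1 j
  ext1
  simp

/-- The bound `p` does not depend on `a`, so `a` may be chosen afterwards in terms of `p`. -/
lemma exists_forall_lt_eq_zero_of_mem_span {M : Type u} [AddCommGroup M] [Module R M] {g : ℕ → M}
    {z : M} (hz : z ∈ Submodule.span R (Set.range g)) : ∃ p : ℕ, ∀ {M' : Type u} [AddCommGroup M']
      [Module R M'] (a : M →ₗ[R] M'), (∀ q < p, a (g q) = 0) → a z = 0 := by
  induction hz using Submodule.span_induction with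
  | mem x hx =>
    obtain ⟨q, rfl⟩ := hx
    exact ⟨q + 1, fun a ha ↦ ha q (Nat.lt_succ_self q)⟩
  | zero => exact ⟨0, fun a _ ↦ map_zero a⟩
  | add x y _ _ hx hy =>
    obtain ⟨p, hp⟩ := hx
    obtain ⟨p', hp'⟩ := hy
    refine ⟨max p p', fun a ha ↦ ?_⟩
    rw [map_add, hp a fun q hq ↦ ha q (lt_max_of_lt_left hq),
      hp' a fun q hq ↦ ha q (lt_max_of_lt_right hq), add_zero]
  | smul r x _ hx =>
    obtain ⟨p, hp⟩ := hx
    exact ⟨p, fun a ha ↦ by rw [map_smul, hp a ha, smul_zero]⟩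

lemma exists_factor_of_mem_span {F : Type u} [AddCommGroup F] [Module R F] (S : Set F) {l : ℕ}
    (x : (Fin l →₀ R) →ₗ[R] Submodule.span R S) :
    ∃ (m : ℕ) (s : Fin m → F) (b : (Fin l →₀ R) →ₗ[R] (Fin m →₀ R)), (∀ i, s i ∈ S) ∧
      (Submodule.span R S).subtype ∘ₗ x = Finsupp.linearCombination R s ∘ₗ b := by
  have hx : ∀ i, ∃ c : S →₀ R, Finsupp.linearCombination R Subtype.val c =
      (x (Finsupp.single i 1) : F) := fun i ↦
    (Finsupp.mem_span_iff_linearCombination R S _).1 (x (Finsupp.single i 1)).2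
  choose c hc using hx
  classical
  let T : Finset S := Finset.univ.biUnion fun i ↦ (c i).support
  let σ : Fin T.card → S := fun j ↦ T.equivFin.symm j
  have hσ : Function.Injective σ := Subtype.val_injective.comp T.equivFin.symm.injective
  refine ⟨T.card, fun j ↦ σ j, Finsupp.linearCombination R fun i ↦
    Finsupp.comapDomain σ (c i) hσ.injOn, fun j ↦ (σ j).2, ?_⟩
  ext1 i
  ext1
  have hmap : Finsupp.mapDomain σ (Finsupp.comapDomain σ (c i) hσ.injOn) = c i := by
    refine Finsupp.mapDomain_comapDomain σ hσ _ fun t ht ↦ ?_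
    have htT : t ∈ T := Finset.mem_biUnion.2 ⟨i, Finset.mem_univ i, ht⟩
    exact ⟨T.equivFin ⟨t, htT⟩, by simp [σ]⟩
  have := hc i
  rw [← hmap, Finsupp.linearCombination_mapDomain] at this
  simpa [Function.comp_def] using this.symm

/-- Over an `ℵ₀`-Noetherian ring, a flat module carries countably many finitary operations such
that subsets closed under these operations span flat submodules. -/
lemma IsAlephZeroNoetherian.exists_flat_span (hR : IsAlephZeroNoetherian R) (F : Type u)
    [AddCommGroup F] [Module R F] [Module.Flat R F] :
    ∃ op : ∀ l : ℕ, ℕ × ℕ → (Fin l → F) → F, ∀ S : Set F,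
      (∀ l q x, (∀ i, x i ∈ S) → op l q x ∈ S) → Module.Flat R (Submodule.span R S) := by
  choose g hg using fun (l : ℕ) (x : Fin l → F) ↦
    hR.exists_span_range_eq (LinearMap.ker (Finsupp.linearCombination R x))
  -- Equational criterion for flatness, applied to the first `p` generating relations of the tuple
  -- `x`.
  have hfac : ∀ (l : ℕ) (x : Fin l → F) (p : ℕ), ∃ (k : ℕ)
      (a : (Fin l →₀ R) →ₗ[R] (Fin k →₀ R)) (y : (Fin k →₀ R) →ₗ[R] F),
      Finsupp.linearCombination R x = y ∘ₗ a ∧ ∀ q < p, a (g l x q) = 0 := by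
    intro l x p
    obtain ⟨k, a, y, hy, ha⟩ := Module.Flat.exists_factorization_of_comp_eq_zero_of_free
      (f := Finsupp.linearCombination R fun q : Fin p ↦ g l x q)
      (x := Finsupp.linearCombination R x) (by
        ext1 q
        ext1
        have : g l x q ∈ LinearMap.ker (Finsupp.linearCombination R x) := by
          rw [← hg l x]
          exact Submodule.subset_span ⟨q, rfl⟩
        simpa using this)
    refine ⟨k, a, y, hy, fun q hq ↦ ?_⟩
    simpa using LinearMap.congr_fun ha (Finsupp.single ⟨q, hq⟩ 1)
  choose k a y hy ha using hfac
  -- Operation `(p, j)` returns the `j`-th witness trivializing the first `p` relations; out of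
  -- range it returns `0`, which enlarges no span.
  refine ⟨fun l q x ↦ if h : q.2 < k l x q.1 then y l x q.1 (Finsupp.single ⟨q.2, h⟩ 1) else 0,
    fun S hS ↦ .of_forall_exists_factorization fun {l f x} hxf ↦ ?_⟩
  obtain ⟨m, s, b, hs, hb⟩ := exists_factor_of_mem_span S x
  have hbf : b f ∈ Submodule.span R (Set.range (g m s)) := by
    rw [hg, LinearMap.mem_ker, ← LinearMap.comp_apply, ← hb, LinearMap.comp_apply, hxf, map_zero]
  obtain ⟨p, hp⟩ := exists_forall_lt_eq_zero_of_mem_span hbf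
  have hyS : ∀ j : Fin (k m s p), y m s p (Finsupp.single j 1) ∈ S := fun j ↦ by
    simpa using hS m (p, j) s hs
  refine ⟨k m s p, a m s p ∘ₗ b, Finsupp.linearCombination R fun j ↦
    ⟨_, Submodule.subset_span (hyS j)⟩, ?_, ?_⟩
  · have hy' : (Submodule.span R S).subtype ∘ₗ Finsupp.linearCombination R
        (fun j ↦ (⟨_, Submodule.subset_span (hyS j)⟩ : Submodule.span R S)) = y m s p := by
      ext1 j
      ext1
      simp
    refine LinearMap.ext fun v ↦ Subtype.ext ?_
    have h1 := LinearMap.congr_fun hb v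
    have h2 := LinearMap.congr_fun hy' (a m s p (b v))
    rw [hy m s p] at h1
    exact h1.trans h2.symm
  · exact hp (a m s p) (ha m s p)

/-- A flat module over an `ℵ₀`-Noetherian ring has a continuous family of flat submodules with few
generators, indexed by the subsets of a generating family. -/
lemma IsAlephZeroNoetherian.exists_flat_submodules (hR : IsAlephZeroNoetherian R) {F : Type u}
    [AddCommGroup F] [Module R F] [Module.Flat R F] {ι : Type u} (x : ι → F) :
    ∃ C : Set ι → Set F, Monotone C ∧ (∀ U, Module.Flat R (Submodule.span R (C U))) ∧
      (∀ U, x '' U ⊆ C U) ∧ (∀ U : Set ι, #(C U) ≤ max ℵ₀ #U) ∧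
      ∀ c : Set (Set ι), c.Nonempty → IsChain (· ⊆ ·) c → C (⋃₀ c) = ⋃ U : c, C U := by
  obtain ⟨op, hop⟩ := hR.exists_flat_span F
  -- Closed subsets become substructures for a countable language: this bounds the size of closures,
  -- and finite arity makes closure commute with unions of chains.
  let L : FirstOrder.Language.{0, 0} := ⟨fun _ ↦ ℕ × ℕ, fun _ ↦ Empty⟩
  let _ : L.Structure F := { funMap := fun {l} q v ↦ op l q v, RelMap := fun r ↦ r.elim }
  let C : Set ι → L.Substructure F := fun U ↦ FirstOrder.Language.Substructure.closure L (x '' U)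
  have hmono : Monotone C := fun U V h ↦
    FirstOrder.Language.Substructure.closure_mono (Set.image_mono h)
  refine ⟨fun U ↦ C U, hmono, fun U ↦ hop _ fun l q v hv ↦ (C U).fun_mem q v hv,
    fun U ↦ FirstOrder.Language.Substructure.subset_closure, fun U ↦ ?_, fun c hne hc ↦ ?_⟩
  · have h1 := FirstOrder.Language.Substructure.lift_card_closure_le (L := L) (s := x '' U)
    have h2 : #(Σ i, L.Functions i) = ℵ₀ := by
      change #(Σ _ : ℕ, ℕ × ℕ) = ℵ₀
      exact mk_eq_aleph0 _
    rw [h2] at h1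
    simp only [lift_aleph0, lift_uzero] at h1
    refine h1.trans (max_le (le_max_left _ _) ?_)
    exact (add_le_max _ _).trans (max_le (max_le (mk_image_le.trans (le_max_right _ _))
      (le_max_left _ _)) (le_max_left _ _))
  · have hne' : Nonempty c := hne.to_subtype
    have hdir : Directed (· ⊆ ·) (fun U : c ↦ (C U : Set F)) := by
      intro U V
      obtain ⟨W, hW, hUW, hVW⟩ := hc.directedOn U U.2 V V.2
      exact ⟨⟨W, hW⟩, hmono hUW, hmono hVW⟩
    let D : L.Substructure F :=
      { carrier := ⋃ U : c, C U
        fun_mem := fun {l} q v hv ↦ by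
          choose U hU using fun i ↦ Set.mem_iUnion.1 (hv i)
          obtain ⟨W, hW⟩ := hdir.finite_le U
          exact Set.mem_iUnion.2 ⟨W, (C W).fun_mem q v fun i ↦ hW i (hU i)⟩ }
    refine Set.Subset.antisymm ?_
      (Set.iUnion_subset fun U ↦ hmono (Set.subset_sUnion_of_mem U.2))
    change C (⋃₀ c) ≤ D
    refine FirstOrder.Language.Substructure.closure_le.2 ?_
    rintro _ ⟨i, ⟨U, hU, hi⟩, rfl⟩
    exact Set.mem_iUnion.2 ⟨⟨U, hU⟩, FirstOrder.Language.Substructure.subset_closure ⟨i, hi, rfl⟩⟩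

lemma hasProjectiveDimensionLT_quotient {n : ℕ} {F : Type u} [AddCommGroup F] [Module R F]
    {D E : Submodule R F} (hDE : D ≤ E)
    (hD : HasProjectiveDimensionLT (ModuleCat.of R D) n)
    (hE : HasProjectiveDimensionLT (ModuleCat.of R E) (n + 1)) :
    HasProjectiveDimensionLT (ModuleCat.of R (E ⧸ D.submoduleOf E)) (n + 1) := by
  have h : Function.Exact (Submodule.inclusion hDE) (D.submoduleOf E).mkQ := by
    rw [LinearMap.exact_iff, Submodule.ker_mkQ, Submodule.range_inclusion]
    rfl
  exact (shortExact_moduleShortComplex h (Submodule.inclusion_injective hDE)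
    (Submodule.mkQ_surjective _)).hasProjectiveDimensionLT_X₃ n hD hE

/-- Induction on the number `κ` of generators. For uncountable `κ`, well-order the generators in
type `κ.ord`; initial segments give flat submodules with fewer generators. Successive quotients need
not be flat, but have finite projective dimension, which `hn` cuts back to at most `n` so that
Eklof's lemma applies. -/
lemma IsAlephZeroNoetherian.hasProjectiveDimensionLT_of_flat (hR : IsAlephZeroNoetherian R)
    {n : ℕ} (hn : ∀ (P : Type u) [AddCommGroup P] [Module R P] [Module.Projective R P],
      HasInjectiveDimensionLT (ModuleCat.of R P) (n + 1))
    (F : Type u) [AddCommGroup F] [Module R F] [Module.Flat R F] :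
    HasProjectiveDimensionLT (ModuleCat.of R F) (n + 1) := by
  suffices ∀ (κ : Cardinal.{u}) (F : Type u) [AddCommGroup F] [Module R F] [Module.Flat R F]
      (S : Set F), #S ≤ κ → Submodule.span R S = ⊤ →
      HasProjectiveDimensionLT (ModuleCat.of R F) (n + 1) from
    this _ F Set.univ le_rfl Submodule.span_univ
  intro κ
  induction κ using WellFoundedLT.induction with
  | ind κ ih =>
  intro F _ _ _ S hS hspan
  obtain hκ | hκ := le_or_gt κ ℵ₀
  · have h2 := hasProjectiveDimensionLT_two_of_flat hR F
      ⟨S, Cardinal.le_aleph0_iff_set_countable.1 (hS.trans hκ), hspan⟩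
    exact hasProjectiveDimensionLT_of_finite hn _ 1
      (hasProjectiveDimensionLT_of_ge _ 2 (n + 1 + 1) (by lia))
  let ι := κ.ord.ToType
  have hι : #ι = κ := by simp [ι]
  obtain ⟨e⟩ : Nonempty (S ↪ ι) := by rwa [← Cardinal.le_def, hι]
  -- Indices that match no generator are sent to `0`.
  let x : ι → F := Function.extend e Subtype.val 0
  obtain ⟨C, hCmono, hCflat, hCx, hCcard, hCcont⟩ := hR.exists_flat_submodules x
  let N : Set ι → Submodule R F := fun U ↦ Submodule.span R (C U)
  have hNmono : Monotone N := fun U V h ↦ Submodule.span_mono (hCmono h)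
  have hsmall : ∀ U : Set ι, #U < κ → HasProjectiveDimensionLT (ModuleCat.of R (N U)) (n + 1) := by
    intro U hU
    have := hCflat U
    refine ih #(C U) ((hCcard U).trans_lt (max_lt hκ hU)) (N U)
      (Subtype.val ⁻¹' (C U)) ?_ Submodule.span_span_coe_preimage
    exact mk_preimage_of_injective _ _ Subtype.val_injective
  have hIio : ∀ i : ι, #(Set.Iio i) < κ := fun i ↦ by
    have := mk_Iio_lt i (by simp [ι])
    rwa [hι] at this
  have hIic : ∀ i : ι, #(Set.Iic i) < κ := fun i ↦ by
    rw [← Set.Iio_insert]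
    exact mk_insert_le.trans_lt (add_lt_of_lt hκ.le (hIio i) (one_lt_aleph0.trans hκ))
  refine hasProjectiveDimensionLT_of_liftsAlong n F fun J Z _ _ _ _ π _ hπ ↦ ?_
  refine liftsAlong_of_filtration hNmono (fun c hne hc y hy ↦ ?_) ?_
    (hπ _ (hsmall ∅ (by simpa using aleph0_pos.trans hκ))) fun i ↦ hπ _ ?_
  · have hne' : Nonempty c := hne.to_subtype
    have hdir : Directed (· ≤ ·) (fun U : c ↦ N U) := by
      intro U V
      obtain ⟨W, hW, hUW, hVW⟩ := hc.directedOn U U.2 V V.2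
      exact ⟨⟨W, hW⟩, hNmono hUW, hNmono hVW⟩
    change y ∈ Submodule.span R (C (⋃₀ c)) at hy
    rw [hCcont c hne hc, Submodule.span_iUnion, Submodule.mem_iSup_of_directed _ hdir] at hy
    obtain ⟨U, hU⟩ := hy
    exact ⟨U, U.2, hU⟩
  · rw [eq_top_iff, ← hspan]
    refine Submodule.span_mono fun s hs ↦ hCx _ ⟨e ⟨s, hs⟩, trivial, ?_⟩
    exact e.injective.extend_apply _ _ _
  · have := hsmall _ (hIic i)
    exact hasProjectiveDimensionLT_of_finite hn _ 1
      (hasProjectiveDimensionLT_quotient (hNmono Set.Iio_subset_Iic_self) (hsmall _ (hIio i))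
        (hasProjectiveDimensionLT_of_ge _ (n + 1) (n + 1 + 1) (Nat.le_succ _)))

end FlatSubmodules

/-! ### Comparison of `silp` and `spli`. -/

section Main

variable {R : Type u} [CommRing R]

lemma silp_le_natCast_iff {n : ℕ} : silp R ≤ n ↔
    ∀ (P : Type u) [AddCommGroup P] [Module R P] [Module.Projective R P],
      HasInjectiveDimensionLT (ModuleCat.of R P) (n + 1) := by
  rw [silp, iSup₂_le_iff]
  exact ⟨fun h P _ _ hP ↦ (injectiveDimension_le_iff _ n).1 (h (ModuleCat.of R P) hP),
    fun h P hP ↦ (injectiveDimension_le_iff _ n).2 (h P)⟩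

lemma spli_le_natCast_iff {n : ℕ} : spli R ≤ n ↔
    ∀ (E : Type u) [AddCommGroup E] [Module R E] [Module.Injective R E],
      HasProjectiveDimensionLT (ModuleCat.of R E) (n + 1) := by
  rw [spli, iSup₂_le_iff]
  exact ⟨fun h E _ _ hE ↦ (projectiveDimension_le_iff _ n).1 (h (ModuleCat.of R E) hE),
    fun h E hE ↦ (projectiveDimension_le_iff _ n).2 (h E)⟩

lemma IsAlephZeroNoetherian.silp_le_iff_spli_le (hR : IsAlephZeroNoetherian R) (n : ℕ) :
    silp R ≤ n ↔ spli R ≤ n := by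
  choose d hdI hd using fun I : Ideal R ↦ hR.exists_resolution (idealInFinsupp I)
  rw [silp_le_natCast_iff, spli_le_natCast_iff]
  constructor
  · intro hn E _ _ _
    have hT : ∀ I, TensorExact (d I) n E := fun I ↦ tensorExact_of_homExact_free (hd I)
      (fun X _ _ _ ↦ homExact_of_hasInjectiveDimensionLT (hd I) n X (hn X) n le_rfl)
      (fun X _ _ _ ↦ homExact_of_hasInjectiveDimensionLT (hd I) n X (hn X) (n + 1) (Nat.le_succ n))
      E
    -- This only gives the bound `2n`: flat dimension at most `n`, and `n` more for the flat syzygy.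
    have := hasProjectiveDimensionLT_of_tensorExact hdI hd
      (fun F _ _ _ ↦ hR.hasProjectiveDimensionLT_of_flat hn F) n E hT
    exact hasProjectiveDimensionLT_of_finite hn _ n (by rwa [add_right_comm] at this)
  · intro hn P _ _ _
    -- Mittag-Leffler consumes two consecutive degrees and concludes in the upper one, so the first
    -- bound is `n + 1`.
    refine hasInjectiveDimensionLT_of_finite hn _ 1
      (hasInjectiveDimensionLT_of_homExact hdI hd (n + 1) P fun I ↦ ?_)
    exact homExact_of_tensorExact_injective (hd I)
      (fun E _ _ _ ↦ tensorExact_of_hasProjectiveDimensionLT (hd I) n E (hn E) n le_rfl)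
      (fun E _ _ _ ↦
        tensorExact_of_hasProjectiveDimensionLT (hd I) n E (hn E) (n + 1) (Nat.le_succ n)) P

lemma silp_eq_bot_iff : silp R = ⊥ ↔ Subsingleton R := by
  simp only [silp, iSup_eq_bot, injectiveDimension_eq_bot_iff, ModuleCat.isZero_iff_subsingleton]
  refine ⟨fun h ↦ h (ModuleCat.of R R) inferInstance, fun _ P _ ↦ ?_⟩
  exact Module.subsingleton R P

lemma spli_eq_bot_iff : spli R = ⊥ ↔ Subsingleton R := by
  simp only [spli, iSup_eq_bot, projectiveDimension_eq_bot_iff, ModuleCat.isZero_iff_subsingleton]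
  refine ⟨fun h ↦ ?_, fun _ E _ ↦ Module.subsingleton R E⟩
  obtain ⟨J, _, _, -, -, -, α, -, hJ, hα, -⟩ := exists_injective_presentation R R
  have : Subsingleton J := h (ModuleCat.of R J) hJ
  exact hα.subsingleton

/-- Natural upper bounds cannot tell `⊥` from `0`, so the zero ring is treated separately through
`hbot`. -/
lemma WithBot.le_of_forall_natCast_le {a b : WithBot ℕ∞} (hbot : b = ⊥ → a = ⊥)
    (h : ∀ n : ℕ, b ≤ n → a ≤ n) : a ≤ b := by
  induction b with
  | bot => exact (hbot rfl).le
  | coe b =>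
    induction b with
    | top => exact le_top
    | coe n => exact h n le_rfl

end Main

theorem corollary5p8 (R : Type u) [CommRing R] (hR : IsAlephZeroNoetherian R) :
    silp R = spli R :=
  le_antisymm
    (WithBot.le_of_forall_natCast_le (fun h ↦ silp_eq_bot_iff.2 (spli_eq_bot_iff.1 h))
      fun n ↦ (hR.silp_le_iff_spli_le n).2)
    (WithBot.le_of_forall_natCast_le (fun h ↦ spli_eq_bot_iff.2 (silp_eq_bot_iff.1 h))
      fun n ↦ (hR.silp_le_iff_spli_le n).1)
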